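/- **Setting.** Two replicated, non-colluding servers each store three independent, uniformly distributed messages $W_1,W_2,W_3$ of $L=8$ bits. To retrieve $W_\theta$, the user draws private randomness independent of the messages and sends a query $Q_n^{[\theta]}$ to server $n\in\{1,2\}$, which answers with a bit string $A_n^{[\theta]}$ that is a deterministic function of the query and of the three messages; the number $d_n$ of bits downloaded from server $n$ is determined by the query (so mixed strategies are allowed). A scheme is *correct* if $H(W_\theta\mid A_{1:2}^{[\theta]},Q_{1:2}^{[\theta]})=0$ for every $\theta$, *private* if for $n=1,2$ the distribution of $Q_n^{[\theta]}$ does not depend on $\theta$ (equivalently $I(\theta;Q_n^{[\theta]})=0$), and has rate $8/\mathbb E[d_1+d_2]$. *Stochastic time sharing* between two schemes means that in each epoch one of them is applied, chosen at random with fixed probabilities. Updates are requested one after the other without waiting, the scheme being applied with fresh independent randomness in each epoch. The $i$-th bit ever downloaded from server $n$ takes a time $Z_{n,i}$; the $Z_{n,i}$ are positive, mutually independent, independent of the user's randomness, of finite variance, and for each $n$ identically distributed with mean $\mu_n$. All bits pass through one queue, so an epoch lasts the sum of the delays of its bits. Update $j$ is time-stamped when it is requested and is received at time $s_j$. The age is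 $a(t)=t-u(t)$, with $u(t)$ the time stamp of the latest update received by time $t$ ($u(t)=0$ if there is none); with $l(T)$ the number of updates received by time $T$, the peak age of information is $$\mathrm{pAoI}=\limsup_{T\to\infty}\mathbb E\Big[\frac1{l(T)}\sum_{j=1}^{l(T)}a(s_j^-)\Big].$$ Let $\alpha^*(R_{\min})$ be the minimum of $\mathrm{pAoI}$ over all correct and private schemes of rate at least $R_{\min}$. **Theorem.** Assume $\mu_1\le\mu_2$. Whatever the desired index $\theta$, the minimum $\alpha^*(R_{\min})$ exists and is given by * for $R_{\min}\in[\tfrac12,\tfrac47]$: $$\alpha^*(R_{\min})=\min\Big\{16\mu_1+12\mu_2,\ 16\Big[\tfrac52(\mu_2-\mu_1)+\tfrac1{R_{\min}}(2\mu_1-\mu_2)\Big]\Big\};$$ * for $R_{\min}\in[\tfrac13,\tfrac12]$: $$\alpha^*(R_{\min})=\min\Big\{16\mu_1+12\mu_2,\ 24\mu_1+8\mu_2,\ 8\Big[3(\mu_2-\mu_1)+\tfrac1{R_{\min}}(3\mu_1-\mu_2)\Big]\Big\}.$$ In both ranges $\alpha^*(R_{\min})$ is also the optimal value of the linear program of minimizing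 $2(\mu_1d_1+\mu_2d_2)$ over real $d_1,d_2\ge 0$ and $D=d_1+d_2$ subject to $\tfrac74L\le D\le L/R_{\min}$ and $d_n\ge\max\{\tfrac32L-\tfrac12D,\ \tfrac52L-D\}$ for $n=1,2$, where $L=8$. Moreover there are correct and private schemes $S_{\mathrm I},S_{\mathrm{III}},S_{\mathrm{IV}}$, not depending on the delays or on $R_{\min}$, with constant download sizes $(d_1,d_2)=(24,0)$, $(8,6)$, $(12,4)$ respectively, such that the terms of the minima are attained, under the rate constraint $R_{\min}$, as follows: $16\mu_1+12\mu_2$ by $S_{\mathrm{III}}$; for $R_{\min}\in[\tfrac12,\tfrac47]$ the second term by time sharing that uses $S_{\mathrm{IV}}$ with probability $\tfrac4{R_{\min}}-7$ and $S_{\mathrm{III}}$ otherwise; for $R_{\min}\in[\tfrac13,\tfrac12]$ the term $24\mu_1+8\mu_2$ by $S_{\mathrm{IV}}$, and the third term by time sharing that uses $S_{\mathrm I}$ with probability $\tfrac1{R_{\min}}-2$ and $S_{\mathrm{IV}}$ otherwise. The optimal value $\alpha^*$ is non-decreasing in $R_{\min}\in[\tfrac13,\tfrac47]$. -/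

import Mathlib

open MeasureTheory ProbabilityTheory Filter
open scoped ENNReal

/-- The contents of a replicated server: `M` messages of `L` bits each. -/
abbrev Library (M L : ℕ) : Type := Fin M → Fin L → Bool

/-- A retrieval strategy for `N` replicated servers holding `M` messages of `L` bits.
The user draws private randomness (`Seed`, with law `law`) independently of the messages, sends
a query (a bit string) to every server, and every server returns a bit string that is a
deterministic function of its query and of the library. The number of bits downloaded from a
server is fixed by the query. The user decodes from the queries and the answers. Randomised
(mixed) strategies are included, since the query may select between several strategies. -/
structure PIRScheme (N M L : ℕ) where
  /-- private randomness of the user -/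
  Seed : Type
  [seedSpace : MeasurableSpace Seed]
  /-- distribution of the private randomness -/
  law : Measure Seed
  [law_prob : IsProbabilityMeasure law]
  /-- `query n θ f` is the query to server `n` when message `θ` is desired -/
  query : Fin N → Fin M → Seed → List Bool
  query_meas : ∀ n θ q, MeasurableSet {f | query n θ f = q}
  /-- number of bits requested from server `n` by a query -/
  size : Fin N → List Bool → ℕ
  /-- answer of server `n` -/
  answer : Fin N → List Bool → Library M L → List Bool
  answer_length : ∀ n q W, (answer n q W).length = size n q
  /-- decoder: desired index, all queries, all answers ↦ message -/
  decode : Fin M → (Fin N → List Bool) → (Fin N → List Bool) → Fin L → Bool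

attribute [instance] PIRScheme.seedSpace PIRScheme.law_prob

namespace PIRScheme

variable {N M L : ℕ}

/-- Number of bits downloaded from server `n` when message `θ` is desired. -/
def download (S : PIRScheme N M L) (n : Fin N) (θ : Fin M) (f : S.Seed) : ℕ :=
  S.size n (S.query n θ f)

/-- Correctness, `H(W_θ | A_{1:N}, Q_{1:N}) = 0`: almost surely in the user's randomness and for
every content of the library, the queries and answers determine the desired message. -/
def IsCorrect (S : PIRScheme N M L) : Prop :=
  ∀ θ : Fin M, ∀ᵐ f ∂S.law, ∀ W : Library M L,
    S.decode θ (fun n => S.query n θ f) (fun n => S.answer n (S.query n θ f) W) = W θ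

/-- Perfect privacy, `I(θ; Q_n) = 0`: for each single server the distribution of the query
does not depend on the desired index. -/
def IsPrivate (S : PIRScheme N M L) : Prop :=
  ∀ (n : Fin N) (θ θ' : Fin M) (q : List Bool),
    S.law {f | S.query n θ f = q} = S.law {f | S.query n θ' f = q}

/-- The expected total download cost `𝔼[D]`. -/
noncomputable def expectedDownload (S : PIRScheme N M L) (θ : Fin M) : ℝ≥0∞ :=
  ∫⁻ f, ∑ n, (S.download n θ f : ℝ≥0∞) ∂S.law

/-- The retrieval rate `L / 𝔼[D]`. -/
noncomputable def rate (S : PIRScheme N M L) (θ : Fin M) : ℝ≥0∞ :=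
  (L : ℝ≥0∞) / S.expectedDownload θ

/-- The constraints of the timely PIR problem with minimum retrieval rate `Rmin`. -/
def Feasible (S : PIRScheme N M L) (Rmin : ℝ) : Prop :=
  S.IsCorrect ∧ S.IsPrivate ∧ ∀ θ, ENNReal.ofReal Rmin ≤ S.rate θ

/-- A pure strategy: exactly `d n` bits are downloaded from server `n`, whatever the desired
message and the user's randomness. -/
def HasSizes (S : PIRScheme N M L) (d : Fin N → ℕ) : Prop :=
  ∀ n θ f, S.download n θ f = d n

/-- The law on `Bool` giving `true` probability `p`. -/
noncomputable def coin (p : unitInterval) : Measure Bool :=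
  ENNReal.ofReal (p : ℝ) • Measure.dirac true + ENNReal.ofReal (1 - (p : ℝ)) • Measure.dirac false

instance (p : unitInterval) : IsProbabilityMeasure (coin p) := by
  constructor
  have h0 : (0 : ℝ) ≤ p := p.2.1
  have h1 : (0 : ℝ) ≤ 1 - p := by linarith [p.2.2]
  simp [coin, ← ENNReal.ofReal_add h0 h1]

/-- Stochastic time sharing: with probability `p` use `S`, otherwise use `S'`. The choice is
announced to the servers by the first bit of the queries. -/
noncomputable def timeShare (p : unitInterval) (S S' : PIRScheme N M L) : PIRScheme N M L where
  Seed := Bool × S.Seed × S'.Seed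
  law := (coin p).prod (S.law.prod S'.law)
  query n θ f := if f.1 then true :: S.query n θ f.2.1 else false :: S'.query n θ f.2.2
  query_meas n θ q := by
    have e : {f : Bool × S.Seed × S'.Seed |
        (if f.1 then true :: S.query n θ f.2.1 else false :: S'.query n θ f.2.2) = q} =
        ({true} ×ˢ ({f | S.query n θ f = q.tail ∧ q = true :: q.tail} ×ˢ Set.univ)) ∪
        ({false} ×ˢ (Set.univ ×ˢ {f | S'.query n θ f = q.tail ∧ q = false :: q.tail})) := by
      ext ⟨b, f, f'⟩
      cases b <;> rcases q with _ | ⟨_ | _, q⟩ <;> simp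
    rw [e]
    refine MeasurableSet.union ?_ ?_
    · exact (measurableSet_singleton _).prod
        (((S.query_meas n θ q.tail).inter (MeasurableSet.const _)).prod MeasurableSet.univ)
    · exact (measurableSet_singleton _).prod
        (MeasurableSet.univ.prod ((S'.query_meas n θ q.tail).inter (MeasurableSet.const _)))
  size n q := match q with
    | [] => 0
    | true :: q => S.size n q
    | false :: q => S'.size n q
  answer n q W := match q with
    | [] => []
    | true :: q => S.answer n q W
    | false :: q => S'.answer n q W
  answer_length n q W := by
    rcases q with _ | ⟨_ | _, q⟩
    · rfl
    · exact S'.answer_length n q W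
    · exact S.answer_length n q W
  decode θ Q A :=
    if ∀ n, (Q n).head? = some true then S.decode θ (fun n => (Q n).tail) A
    else S'.decode θ (fun n => (Q n).tail) A

end PIRScheme

/-! ### Age of information along a sample path

`d n j` is the number of bits downloaded from server `n` in the epoch with (0-based) number `j`,
and `z n i` is the delay of the bit number `i` (0-based) received from server `n`. -/

section Age

variable {N : ℕ}

/-- Duration of epoch `j`: the bits of all servers pass through a single queue. -/
def epochTime (d : Fin N → ℕ → ℕ) (z : Fin N → ℕ → ℝ) (j : ℕ) : ℝ :=
  ∑ n, ∑ i ∈ Finset.Ico (∑ k ∈ Finset.range j, d n k) (∑ k ∈ Finset.range (j + 1), d n k), z n i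

/-- Time at which the `j`-th status update (`j ≥ 1`) is received; `0` for `j = 0`. -/
def receiveTime (d : Fin N → ℕ → ℕ) (z : Fin N → ℕ → ℝ) (j : ℕ) : ℝ :=
  ∑ k ∈ Finset.range j, epochTime d z k

/-- Time stamp of the `j`-th status update (`j ≥ 1`): it is requested, and stamped, as soon as
the preceding one has been received (zero-wait policy). -/
def timeStamp (d : Fin N → ℕ → ℕ) (z : Fin N → ℕ → ℝ) (j : ℕ) : ℝ :=
  receiveTime d z (j - 1)

/-- Time stamp of the latest update received by time `t` (`0` if there is none). -/
noncomputable def latestStamp (d : Fin N → ℕ → ℕ) (z : Fin N → ℕ → ℝ) (t : ℝ) : ℝ :=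
  sSup {u | ∃ j, 1 ≤ j ∧ receiveTime d z j ≤ t ∧ u = timeStamp d z j}

/-- Age of information at time `t`. -/
noncomputable def age (d : Fin N → ℕ → ℕ) (z : Fin N → ℕ → ℝ) (t : ℝ) : ℝ :=
  t - latestStamp d z t

/-- Number of status updates received by time `t`. -/
noncomputable def numUpdates (d : Fin N → ℕ → ℕ) (z : Fin N → ℕ → ℝ) (t : ℝ) : ℕ :=
  Set.ncard {j : ℕ | 1 ≤ j ∧ receiveTime d z j ≤ t}

/-- Mean of the peaks of the age (left limits at the reception times) up to time `t`. -/
noncomputable def meanPeak (d : Fin N → ℕ → ℕ) (z : Fin N → ℕ → ℝ) (t : ℝ) : ℝ :=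
  (1 / (numUpdates d z t : ℝ)) *
    ∑ j ∈ Finset.Icc 1 (numUpdates d z t), Function.leftLim (age d z) (receiveTime d z j)

end Age

/-- Delay model: the delays `Z n i` are independent, positive, have finite variance, and for each
server `n` they are identically distributed with mean `μ n`. -/
structure IsDelayModel {Ω : Type*} [MeasurableSpace Ω] (P : Measure Ω) {N : ℕ}
    (Z : Fin N → ℕ → Ω → ℝ) (μ : Fin N → ℝ) : Prop where
  meas : ∀ n i, Measurable (Z n i)
  indep : iIndepFun (fun x : Fin N × ℕ => Z x.1 x.2) P
  ident : ∀ n i, IdentDistrib (Z n i) (Z n 0) P P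
  pos : ∀ n i, ∀ᵐ ω ∂P, 0 < Z n i ω
  finite_variance : ∀ n i, MemLp (Z n i) 2 P
  mean : ∀ n, ∫ ω, Z n 0 ω ∂P = μ n

/-- Long-term peak age when the desired message is `θ` and the user applies `S` in every epoch
with fresh randomness, independent over epochs and independent of the delays. -/
noncomputable def peakAoI {Ω : Type*} [MeasurableSpace Ω] (P : Measure Ω) {N M L : ℕ}
    (Z : Fin N → ℕ → Ω → ℝ) (S : PIRScheme N M L) (θ : Fin M) : ℝ≥0∞ :=
  limsup (fun t : ℝ =>
    ∫⁻ x : Ω × (ℕ → S.Seed),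
      ENNReal.ofReal (meanPeak (fun n j => S.download n θ (x.2 j)) (fun n i => Z n i x.1) t)
      ∂(P.prod (Measure.infinitePi fun _ : ℕ => S.law))) atTop

/-- Objective values of the timely PIR problem with the peak-age metric. -/
def peakValues {Ω : Type*} [MeasurableSpace Ω] (P : Measure Ω) {N : ℕ} (M L : ℕ)
    (Z : Fin N → ℕ → Ω → ℝ) (θ : Fin M) (Rmin : ℝ) : Set ℝ≥0∞ :=
  {v | ∃ S : PIRScheme N M L, S.Feasible Rmin ∧ v = peakAoI P Z S θ}

/-- Objective values of the linear program over download sizes to which the problem with two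
servers and three messages of `L` bits is reduced. -/
def lpValues (L : ℝ) (μ : Fin 2 → ℝ) (Rmin : ℝ) : Set ℝ :=
  {v | ∃ (d : Fin 2 → ℝ) (D : ℝ), (∀ n, 0 ≤ d n) ∧ ∑ n, d n = D ∧
    7 / 4 * L ≤ D ∧ D ≤ L / Rmin ∧
    (∀ n, max (3 / 2 * L - 1 / 2 * D) (5 / 2 * L - D) ≤ d n) ∧ v = 2 * ∑ n, μ n * d n}

/-! ### Sample paths -/

section Path

variable {N : ℕ} {d : Fin N → ℕ → ℕ} {z : Fin N → ℕ → ℝ}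

/-! Write `s j` for the reception times. Just before update `j + 1` arrives the freshest stamp is `s
(j - 1)`, so the peak is `s (j + 1) - s (j - 1)` and the first `l` peaks telescope to `s l + s (l -
1)`. The strong law, applied to the delays and to the download sizes, gives `s l / l → c`, where `c
= ∑ n, μ n * 𝔼[d n]`, so the mean peak tends almost surely to `2 * c`. Passing to expectations is
asymmetric. For an arbitrary feasible scheme Fatou's lemma gives `2 * c` as a lower bound
(`le_peakAoI`); for bounded download sizes dominated convergence gives equality (`peakAoI_eq`).
Minimizing the age thus means minimizing a linear function of the mean download sizes.

The converse measures an answer by the average logarithm of the number of its values given some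
messages (`condInfo`). For deterministic answers this has every property of entropy that is needed:
it is at most the length, it is subadditive, it does not grow under functions, and decoding a
message costs `L` bits (concavity of the logarithm). Applying the last fact to messages 0, 1, 2 in
turn, and identifying the averages for different desired messages by privacy, yields the constraints
of the linear program (`meanDownload_bounds`).

For total download `D`, the cheapest split gives the slower server as little as allowed. The cost is
then convex and piecewise linear in `D` with a break at `D = 16`, hence minimal at `14`, `16` or `8
/ R`. The first two points are attained by `quadScheme` and `pairScheme`, the last by time sharing
between adjacent schemes, `fullScheme` being the one at `D = 24`. -/

lemma receiveTime_eq (d : Fin N → ℕ → ℕ) (z : Fin N → ℕ → ℝ) (l : ℕ) :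
    receiveTime d z l = ∑ n, ∑ i ∈ Finset.range (∑ k ∈ Finset.range l, d n k), z n i := by
  induction l with
  | zero => simp [receiveTime]
  | succ l ih =>
    rw [receiveTime, Finset.sum_range_succ, ← receiveTime, ih, epochTime, ← Finset.sum_add_distrib]
    refine Finset.sum_congr rfl fun n _ => ?_
    refine Finset.sum_range_add_sum_Ico _ ?_
    rw [Finset.sum_range_succ]
    exact Nat.le_add_right _ _

@[simp]
lemma receiveTime_zero : receiveTime d z 0 = 0 := by simp [receiveTime]

lemma epochTime_pos (hz : ∀ n i, 0 < z n i) (hd : ∀ j, ∃ n, 0 < d n j) (j : ℕ) :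
    0 < epochTime d z j := by
  obtain ⟨n, hn⟩ := hd j
  refine Finset.sum_pos' (fun m _ => Finset.sum_nonneg fun i _ => (hz m i).le)
    ⟨n, Finset.mem_univ _, Finset.sum_pos (fun i _ => hz n i) ?_⟩
  rw [Finset.nonempty_Ico, Finset.sum_range_succ]
  omega

lemma receiveTime_strictMono (hz : ∀ n i, 0 < z n i) (hd : ∀ j, ∃ n, 0 < d n j) :
    StrictMono (receiveTime d z) := by
  refine strictMono_nat_of_lt_succ fun j => ?_
  simp only [receiveTime, Finset.sum_range_succ]
  linarith [epochTime_pos hz hd j]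

lemma numUpdates_eq {t : ℝ} {l : ℕ} (hs : StrictMono (receiveTime d z))
    (h₁ : receiveTime d z l ≤ t) (h₂ : t < receiveTime d z (l + 1)) : numUpdates d z t = l := by
  have e : {j : ℕ | 1 ≤ j ∧ receiveTime d z j ≤ t} = ↑(Finset.Icc 1 l) := by
    ext j
    simp only [Set.mem_ofPred_eq, Finset.coe_Icc, Set.mem_Icc, and_congr_right_iff]
    refine fun _ => ⟨fun h => ?_, fun h => (hs.monotone h).trans h₁⟩
    exact Nat.lt_succ_iff.1 (hs.lt_iff_lt.1 (h.trans_lt h₂))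
  rw [numUpdates, e, Set.ncard_coe_finset]
  simp

lemma latestStamp_eq {t : ℝ} {l : ℕ} (hs : StrictMono (receiveTime d z))
    (h₁ : receiveTime d z l ≤ t) (h₂ : t < receiveTime d z (l + 1)) :
    latestStamp d z t = receiveTime d z (l - 1) := by
  rcases Nat.eq_zero_or_pos l with rfl | hl
  -- Before the first update the supremum is over the empty set, hence `0`, which is also
  -- `receiveTime d z (0 - 1)` by truncated subtraction.
  · have e : {u | ∃ j, 1 ≤ j ∧ receiveTime d z j ≤ t ∧ u = timeStamp d z j} = ∅ := by
      refine Set.eq_empty_of_forall_notMem ?_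
      rintro u ⟨j, hj, hjt, -⟩
      exact absurd (hs.lt_iff_lt.1 (hjt.trans_lt h₂)) (by omega)
    simp [latestStamp, e]
  · refine IsGreatest.csSup_eq ⟨⟨l, hl, h₁, rfl⟩, ?_⟩
    rintro u ⟨j, hj, hjt, rfl⟩
    have := hs.lt_iff_lt.1 (hjt.trans_lt h₂)
    exact hs.monotone (by omega)

/-- The peak of the age just before update `j + 1` is received. -/
lemma leftLim_age (hs : StrictMono (receiveTime d z)) (j : ℕ) :
    Function.leftLim (age d z) (receiveTime d z (j + 1)) =
      receiveTime d z (j + 1) - receiveTime d z (j - 1) := by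
  refine leftLim_eq_of_tendsto ?_
  have h : Tendsto (fun t : ℝ => t - receiveTime d z (j - 1))
      (nhdsWithin (receiveTime d z (j + 1)) (Set.Iio (receiveTime d z (j + 1))))
      (nhds (receiveTime d z (j + 1) - receiveTime d z (j - 1))) :=
    ((continuous_id.sub continuous_const).tendsto _).mono_left nhdsWithin_le_nhds
  refine h.congr' ?_
  filter_upwards [Ico_mem_nhdsLT (hs (Nat.lt_succ_self j))] with t ht
  rw [age, latestStamp_eq hs ht.1 ht.2]

/-- The peaks are differences of reception times two steps apart, so their sum telescopes to the
last two times, the initial ones being `0`. -/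
lemma sum_leftLim_age (hs : StrictMono (receiveTime d z)) (l : ℕ) :
    ∑ j ∈ Finset.Icc 1 l, Function.leftLim (age d z) (receiveTime d z j) =
      receiveTime d z l + receiveTime d z (l - 1) := by
  induction l with
  | zero => simp
  | succ l ih =>
    rw [Finset.sum_Icc_succ_top (by omega), ih, leftLim_age hs]
    simp only [Nat.add_sub_cancel]
    ring

lemma meanPeak_eq {t : ℝ} {l : ℕ} (hs : StrictMono (receiveTime d z))
    (h₁ : receiveTime d z l ≤ t) (h₂ : t < receiveTime d z (l + 1)) :
    meanPeak d z t = (receiveTime d z l + receiveTime d z (l - 1)) / l := by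
  rw [meanPeak, numUpdates_eq hs h₁ h₂, sum_leftLim_age hs, one_div, inv_mul_eq_div]

lemma exists_receiveTime_le_lt (htop : Tendsto (receiveTime d z) atTop atTop) {t : ℝ}
    (ht : 0 ≤ t) : ∃ l, receiveTime d z l ≤ t ∧ t < receiveTime d z (l + 1) := by
  classical
  have hex : ∃ l, t < receiveTime d z l := (htop.eventually_gt_atTop t).exists
  have h0 : Nat.find hex ≠ 0 := fun h => by
    have := Nat.find_spec hex
    rw [h, receiveTime_zero] at this
    exact this.not_ge ht
  obtain ⟨l, hl⟩ := Nat.exists_eq_succ_of_ne_zero h0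
  refine ⟨l, not_lt.1 (Nat.find_min hex (by omega)), ?_⟩
  rw [← Nat.succ_eq_add_one, ← hl]
  exact Nat.find_spec hex

/-- If partial means of `z` and of the block lengths converge, so do the block sums. -/
lemma tendsto_sum_range_sum_div {y : ℕ → ℝ} {e : ℕ → ℕ} {m δ : ℝ}
    (hy : Tendsto (fun k : ℕ => (∑ i ∈ Finset.range k, y i) / k) atTop (nhds m))
    (he : Tendsto (fun l : ℕ => (∑ k ∈ Finset.range l, (e k : ℝ)) / l) atTop (nhds δ)) :
    Tendsto (fun l : ℕ => (∑ i ∈ Finset.range (∑ k ∈ Finset.range l, e k), y i) / l) atTop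
      (nhds (m * δ)) := by
  set E : ℕ → ℕ := fun l => ∑ k ∈ Finset.range l, e k with hE
  set Y : ℕ → ℝ := fun k => ∑ i ∈ Finset.range k, y i with hY
  have he' : Tendsto (fun l : ℕ => (E l : ℝ) / l) atTop (nhds δ) := by
    simpa [hE] using he
  have hfac : ∀ l : ℕ, Y (E l) / l = Y (E l) / E l * ((E l : ℝ) / l) := by
    intro l
    rcases eq_or_ne (E l) 0 with h | h
    · simp [h, hY]
    · have : (E l : ℝ) ≠ 0 := by exact_mod_cast h
      field_simp
  have hδ : 0 ≤ δ := ge_of_tendsto' he' fun l => by positivity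
  refine Tendsto.congr (fun l => (hfac l).symm) ?_
  -- If `δ = 0` the block ends `E l` may stay bounded (a server that is never used), so the means of
  -- `y` along `E` need not tend to `m`; their boundedness suffices.
  rcases hδ.eq_or_lt with h0 | hpos
  · obtain ⟨C, hC⟩ := hy.abs.bddAbove_range
    have hC' : ∀ k, |Y k / k| ≤ C := fun k => hC ⟨k, rfl⟩
    rw [← h0, mul_zero]
    rw [← h0] at he'
    refine squeeze_zero_norm (a := fun l : ℕ => C * ((E l : ℝ) / l)) (fun l => ?_)
      (by simpa using he'.const_mul C)
    rw [norm_mul, Real.norm_eq_abs, Real.norm_of_nonneg (by positivity)]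
    exact mul_le_mul_of_nonneg_right (hC' _) (by positivity)
  · have hEtop : Tendsto E atTop atTop := by
      rw [← tendsto_natCast_atTop_iff (R := ℝ)]
      refine (he'.pos_mul_atTop hpos tendsto_natCast_atTop_atTop).congr' ?_
      filter_upwards [eventually_gt_atTop 0] with l hl
      have : (l : ℝ) ≠ 0 := by positivity
      field_simp
    exact (hy.comp hEtop).mul he'

lemma tendsto_receiveTime_div {m δ : Fin N → ℝ}
    (hz : ∀ n, Tendsto (fun k : ℕ => (∑ i ∈ Finset.range k, z n i) / k) atTop (nhds (m n)))
    (hd : ∀ n, Tendsto (fun l : ℕ => (∑ k ∈ Finset.range l, (d n k : ℝ)) / l) atTop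
      (nhds (δ n))) :
    Tendsto (fun l : ℕ => receiveTime d z l / l) atTop (nhds (∑ n, m n * δ n)) := by
  simp_rw [receiveTime_eq, Finset.sum_div (Finset.univ : Finset (Fin N))]
  exact tendsto_finsetSum _ fun n _ => tendsto_sum_range_sum_div (hz n) (hd n)

lemma tendsto_atTop_of_tendsto_div {s : ℕ → ℝ} {c : ℝ} (hc : 0 < c)
    (hs : Tendsto (fun l : ℕ => s l / l) atTop (nhds c)) : Tendsto s atTop atTop := by
  refine (hs.pos_mul_atTop hc tendsto_natCast_atTop_atTop).congr' ?_
  filter_upwards [eventually_gt_atTop 0] with l hl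
  have : (l : ℝ) ≠ 0 := by positivity
  field_simp

lemma tendsto_peak_average {s : ℕ → ℝ} {c : ℝ}
    (hs : Tendsto (fun l : ℕ => s l / l) atTop (nhds c)) :
    Tendsto (fun l : ℕ => (s l + s (l - 1)) / l) atTop (nhds (2 * c)) := by
  rw [← tendsto_add_atTop_iff_nat 1]
  have h₁ := (tendsto_add_atTop_iff_nat 1).2 hs
  have h₂ : Tendsto (fun l : ℕ => s l / l * ((l : ℝ) / (l + 1))) atTop (nhds (c * 1)) :=
    hs.mul (tendsto_natCast_div_add_atTop 1)
  rw [two_mul]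
  refine (h₁.add (by simpa using h₂)).congr' ?_
  filter_upwards [eventually_gt_atTop 0] with l hl
  have : (l : ℝ) ≠ 0 := by positivity
  push_cast
  field_simp

/-- The empirical mean of the peaks converges to twice the mean epoch time. -/
lemma tendsto_meanPeak {c : ℝ} (hc : 0 < c) (hmono : StrictMono (receiveTime d z))
    (hs : Tendsto (fun l : ℕ => receiveTime d z l / l) atTop (nhds c)) :
    Tendsto (meanPeak d z) atTop (nhds (2 * c)) := by
  have htop := tendsto_atTop_of_tendsto_div hc hs
  have hex : ∀ t : ℝ, ∃ l, 0 ≤ t → receiveTime d z l ≤ t ∧ t < receiveTime d z (l + 1) := by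
    intro t
    by_cases ht : 0 ≤ t
    · obtain ⟨l, hl⟩ := exists_receiveTime_le_lt htop ht
      exact ⟨l, fun _ => hl⟩
    · exact ⟨0, fun h => absurd h ht⟩
  choose l hl using hex
  have hltop : Tendsto l atTop atTop := by
    refine tendsto_atTop.2 fun j => ?_
    filter_upwards [eventually_ge_atTop (receiveTime d z j), eventually_ge_atTop 0] with t ht h0
    exact Nat.lt_succ_iff.1 (hmono.lt_iff_lt.1 (ht.trans_lt (hl t h0).2))
  refine ((tendsto_peak_average hs).comp hltop).congr' ?_
  filter_upwards [eventually_ge_atTop 0] with t ht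
  exact (meanPeak_eq hmono (hl t ht).1 (hl t ht).2).symm

end Path

/-! ### Peak age of a scheme -/

namespace PIRScheme

variable {N M L : ℕ}

/-- Queries range over the countable type `List Bool`, so any preimage is a countable union of the
measurable fibres; `g` may be arbitrary. -/
lemma measurable_query_comp {α : Type*} [MeasurableSpace α] (S : PIRScheme N M L) (n : Fin N)
    (θ : Fin M) (g : List Bool → α) : Measurable fun f => g (S.query n θ f) := by
  intro A _
  have e : (fun f => g (S.query n θ f)) ⁻¹' A =
      ⋃ q ∈ {q : List Bool | g q ∈ A}, {f | S.query n θ f = q} := by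
    ext f; simp
  rw [e]
  exact MeasurableSet.biUnion (Set.to_countable _) fun q _ => S.query_meas n θ q

lemma measurable_download (S : PIRScheme N M L) (n : Fin N) (θ : Fin M) :
    Measurable (S.download n θ) :=
  S.measurable_query_comp n θ (S.size n)

/-- Expected number of bits downloaded from server `n`. -/
noncomputable def meanDownload (S : PIRScheme N M L) (n : Fin N) (θ : Fin M) : ℝ :=
  ∫ f, (S.download n θ f : ℝ) ∂S.law

end PIRScheme

/-! ### Delays: law of large numbers and an integrable bound for all empirical means -/

section Delays

variable {Ω : Type*} [MeasurableSpace Ω] {P : Measure Ω} {N : ℕ}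
  {Z : Fin N → ℕ → Ω → ℝ} {μ : Fin N → ℝ}

lemma IsDelayModel.integrable [IsProbabilityMeasure P] (h : IsDelayModel P Z μ) (n : Fin N) (i : ℕ) :
    Integrable (Z n i) P :=
  (h.finite_variance n i).integrable (by norm_num)

lemma IsDelayModel.integral_eq (h : IsDelayModel P Z μ) (n : Fin N) (i : ℕ) :
    ∫ ω, Z n i ω ∂P = μ n :=
  (h.ident n i).integral_eq.trans (h.mean n)

lemma IsDelayModel.mean_pos [IsProbabilityMeasure P] (h : IsDelayModel P Z μ) (n : Fin N) : 0 < μ n := by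
  rw [← h.mean n, integral_pos_iff_support_of_nonneg_ae
    ((h.pos n 0).mono fun ω hω => hω.le) (h.integrable n 0)]
  refine pos_iff_ne_zero.2 fun h0 => ?_
  obtain ⟨ω, h1, h2⟩ := ((measure_eq_zero_iff_ae_notMem.1 h0).and (h.pos n 0)).exists
  exact h1 h2.ne'

lemma IsDelayModel.pairwise_indep (h : IsDelayModel P Z μ) (n : Fin N) :
    Pairwise fun i j => IndepFun (Z n i) (Z n j) P := fun i j hij =>
  h.indep.indepFun (i := (n, i)) (j := (n, j)) (by simpa using hij)

lemma IsDelayModel.ae_pos (h : IsDelayModel P Z μ) : ∀ᵐ ω ∂P, ∀ n i, 0 < Z n i ω :=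
  ae_all_iff.2 fun n => ae_all_iff.2 fun i => h.pos n i

lemma IsDelayModel.ae_tendsto [IsProbabilityMeasure P] (h : IsDelayModel P Z μ) : ∀ᵐ ω ∂P, ∀ n,
    Tendsto (fun k : ℕ => (∑ i ∈ Finset.range k, Z n i ω) / k) atTop (nhds (μ n)) := by
  refine ae_all_iff.2 fun n => ?_
  have := strong_law_ae_real (Z n) (h.integrable n 0) (h.pairwise_indep n) (h.ident n)
  rwa [h.mean n] at this

/-- The second moment of the deviation of an empirical mean of `K` delays is of order `1 / K`. -/
lemma IsDelayModel.integral_sq_deviation [IsProbabilityMeasure P] (h : IsDelayModel P Z μ)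
    (n : Fin N) {K : ℕ} (hK : K ≠ 0) :
    Integrable (fun ω => ((∑ i ∈ Finset.range K, Z n i ω) / K - μ n) ^ 2) P ∧
      ∫ ω, ((∑ i ∈ Finset.range K, Z n i ω) / K - μ n) ^ 2 ∂P = variance (Z n 0) P / K := by
  have hK' : (K : ℝ) ≠ 0 := by exact_mod_cast hK
  have hmem : MemLp (∑ i ∈ Finset.range K, Z n i) 2 P :=
    memLp_finsetSum' _ fun i _ => h.finite_variance n i
  have hmean : ∫ ω, (∑ i ∈ Finset.range K, Z n i) ω ∂P = K * μ n := by
    simp only [Finset.sum_apply]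
    rw [integral_finsetSum _ fun i _ => h.integrable n i]
    simp [h.integral_eq]
  have hvar : variance (∑ i ∈ Finset.range K, Z n i) P = K * variance (Z n 0) P := by
    rw [IndepFun.variance_sum (fun i _ => h.finite_variance n i)
      fun i _ j _ hij => h.pairwise_indep n hij]
    simp [fun i => (h.ident n i).variance_eq]
  have e : (fun ω => ((∑ i ∈ Finset.range K, Z n i ω) / K - μ n) ^ 2) =
      fun ω => ((∑ i ∈ Finset.range K, Z n i) ω - K * μ n) ^ 2 * (1 / (K : ℝ) ^ 2) := by
    funext ω
    simp only [Finset.sum_apply]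
    field_simp
  rw [e]
  constructor
  · exact ((hmem.sub (memLp_const (K * μ n))).integrable_sq).mul_const _
  · rw [integral_mul_const]
    have := variance_eq_integral (μ := P) hmem.aestronglyMeasurable.aemeasurable
    rw [hmean, hvar] at this
    rw [← this]
    field_simp

/-- A bound for all empirical means of a nonnegative sequence in terms of the dyadic ones. -/
noncomputable def dyadicBound (m : ℝ) (y : ℕ → ℝ) : ℝ≥0∞ :=
  2 * (ENNReal.ofReal m + ∑' j : ℕ, ENNReal.ofReal
    ((3 / 4 : ℝ) ^ j + ((∑ i ∈ Finset.range (2 ^ j), y i) / (2 ^ j : ℕ) - m) ^ 2 / (3 / 4) ^ j))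

/-- If `2 ^ j` is the least power of two that is at least `k`, the mean of `k` nonnegative terms is
at most twice the mean `A` of `2 ^ j` terms. Then `A - m ≤ a + (A - m) ^ 2 / a` for every `a > 0`,
used with `a = (3 / 4) ^ j`. -/
lemma ofReal_mean_le_dyadicBound {m : ℝ} {y : ℕ → ℝ} (hm : 0 ≤ m) (hy : ∀ i, 0 ≤ y i) (k : ℕ) :
    ENNReal.ofReal ((∑ i ∈ Finset.range k, y i) / k) ≤ dyadicBound m y := by
  rcases Nat.eq_zero_or_pos k with rfl | hk
  · simp
  obtain ⟨j, hj₁, hj₂⟩ : ∃ j, k ≤ 2 ^ j ∧ 2 ^ j ≤ 2 * k := by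
    refine ⟨Nat.clog 2 k, Nat.le_pow_clog (by norm_num) k, ?_⟩
    rcases Nat.lt_or_ge 1 k with h | h
    · have h1 := Nat.pow_pred_clog_lt_self (b := 2) (by norm_num) h
      have h2 : 0 < Nat.clog 2 k := Nat.clog_pos (by norm_num) h
      obtain ⟨c, hc⟩ := Nat.exists_eq_succ_of_ne_zero h2.ne'
      rw [hc] at h1 ⊢
      simp only [Nat.pred_succ] at h1
      rw [Nat.succ_eq_add_one, pow_succ]
      omega
    · have : k = 1 := by omega
      subst this
      simp
  set A : ℝ := (∑ i ∈ Finset.range (2 ^ j), y i) / (2 ^ j : ℕ) with hA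
  have ha : (0 : ℝ) < (3 / 4) ^ j := by positivity
  have hreal : (∑ i ∈ Finset.range k, y i) / k ≤
      2 * (m + ((3 / 4 : ℝ) ^ j + (A - m) ^ 2 / (3 / 4) ^ j)) := by
    have h1 : (∑ i ∈ Finset.range k, y i) / k ≤ 2 * A := by
      have hk' : (0 : ℝ) < k := by exact_mod_cast hk
      have hle : ∑ i ∈ Finset.range k, y i ≤ ∑ i ∈ Finset.range (2 ^ j), y i :=
        Finset.sum_le_sum_of_subset_of_nonneg (Finset.range_mono hj₁) fun i _ _ => hy i
      have hs : 0 ≤ ∑ i ∈ Finset.range (2 ^ j), y i := Finset.sum_nonneg fun i _ => hy i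
      have hp : (0 : ℝ) < (2 ^ j : ℕ) := by positivity
      have hj₂' : ((2 ^ j : ℕ) : ℝ) ≤ 2 * k := by exact_mod_cast hj₂
      rw [hA, ← mul_div_assoc, div_le_div_iff₀ hk' hp]
      nlinarith
    have h2 : A - m ≤ (3 / 4 : ℝ) ^ j + (A - m) ^ 2 / (3 / 4) ^ j := by
      have : A - m ≤ ((3 / 4 : ℝ) ^ j * (3 / 4 : ℝ) ^ j + (A - m) ^ 2) / (3 / 4) ^ j := by
        rw [le_div_iff₀ ha]
        nlinarith [sq_nonneg ((3 / 4 : ℝ) ^ j - (A - m)), sq_nonneg ((3 / 4 : ℝ) ^ j),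
          sq_nonneg (A - m)]
      rwa [add_div, mul_div_cancel_right₀ _ ha.ne'] at this
    linarith
  refine (ENNReal.ofReal_le_ofReal hreal).trans ?_
  rw [ENNReal.ofReal_mul (by norm_num), ENNReal.ofReal_add hm (by positivity), dyadicBound]
  simp only [ENNReal.ofReal_ofNat]
  gcongr
  exact ENNReal.le_tsum (f := fun j : ℕ => ENNReal.ofReal
    ((3 / 4 : ℝ) ^ j + ((∑ i ∈ Finset.range (2 ^ j), y i) / (2 ^ j : ℕ) - m) ^ 2 / (3 / 4) ^ j)) j

lemma IsDelayModel.measurable_dyadicBound (h : IsDelayModel P Z μ) (n : Fin N) :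
    Measurable fun ω => dyadicBound (μ n) fun i => Z n i ω := by
  have := h.meas
  unfold dyadicBound
  fun_prop

/-- The squared deviation of the mean of `2 ^ j` delays has expectation `Var / 2 ^ j`; divided by
`(3 / 4) ^ j` it is `Var * (2 / 3) ^ j`. A ratio strictly between `1 / 2` and `1` makes both
geometric series converge. -/
lemma IsDelayModel.lintegral_dyadicBound_ne_top [IsProbabilityMeasure P]
    (h : IsDelayModel P Z μ) (n : Fin N) :
    ∫⁻ ω, dyadicBound (μ n) (fun i => Z n i ω) ∂P ≠ ∞ := by
  have hm := h.meas
  have hterm : ∀ j : ℕ, ∫⁻ ω, ENNReal.ofReal ((3 / 4 : ℝ) ^ j +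
      ((∑ i ∈ Finset.range (2 ^ j), Z n i ω) / (2 ^ j : ℕ) - μ n) ^ 2 / (3 / 4) ^ j) ∂P =
      ENNReal.ofReal ((3 / 4 : ℝ) ^ j + variance (Z n 0) P * (2 / 3) ^ j) := by
    intro j
    obtain ⟨hi, he⟩ := h.integral_sq_deviation n (K := 2 ^ j) (by positivity)
    have hi' : Integrable (fun ω => (3 / 4 : ℝ) ^ j +
        ((∑ i ∈ Finset.range (2 ^ j), Z n i ω) / (2 ^ j : ℕ) - μ n) ^ 2 / (3 / 4) ^ j) P :=
      (integrable_const _).add (hi.div_const _)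
    rw [← ofReal_integral_eq_lintegral_ofReal hi' (Eventually.of_forall fun ω => by positivity),
      integral_add (integrable_const _) (hi.div_const _), integral_div, he]
    congr 1
    simp only [integral_const, probReal_univ, one_smul, Nat.cast_pow, Nat.cast_ofNat]
    rw [div_div, ← mul_pow, div_eq_mul_inv (variance (Z n 0) P), ← inv_pow]
    norm_num
  unfold dyadicBound
  rw [lintegral_const_mul _ (by fun_prop), lintegral_add_left (by fun_prop),
    lintegral_tsum (fun j => by fun_prop)]
  simp only [hterm]
  have hv : 0 ≤ variance (Z n 0) P := variance_nonneg _ _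
  have hsum : Summable fun j : ℕ => (3 / 4 : ℝ) ^ j + variance (Z n 0) P * (2 / 3) ^ j :=
    (summable_geometric_of_lt_one (by norm_num) (by norm_num)).add
      ((summable_geometric_of_lt_one (by norm_num) (by norm_num)).mul_left _)
  rw [← ENNReal.ofReal_tsum_of_nonneg (fun j => by positivity) hsum]
  simp [ENNReal.mul_eq_top]

end Delays

/-! ### Peak age as twice the mean epoch time -/

section Peak

variable {Ω : Type*} [MeasurableSpace Ω] {P : Measure Ω} [IsProbabilityMeasure P] {N M L : ℕ}
  {Z : Fin N → ℕ → Ω → ℝ} {μ : Fin N → ℝ} {S : PIRScheme N M L} {θ : Fin M}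

/-- Reception times as random variables on the product of the delay space with the space of the
user's randomness. -/
def pathTime (Z : Fin N → ℕ → Ω → ℝ) (S : PIRScheme N M L) (θ : Fin M) (l : ℕ)
    (x : Ω × (ℕ → S.Seed)) : ℝ :=
  receiveTime (fun n j => S.download n θ (x.2 j)) (fun n i => Z n i x.1) l

lemma measurable_pathTime (hZ : ∀ n i, Measurable (Z n i)) (l : ℕ) :
    Measurable (pathTime Z S θ l) := by
  unfold pathTime
  simp only [receiveTime_eq]
  refine Finset.measurable_fun_sum _ fun n _ => ?_
  -- The number of delays summed is itself random, so measurability is needed jointly in the number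
  -- and the sample point.
  have h₁ : Measurable fun y : ℕ × Ω => ∑ i ∈ Finset.range y.1, Z n i y.2 :=
    measurable_from_prod_countable_right fun k =>
      Finset.measurable_fun_sum (Finset.range k) fun i _ => hZ n i
  have h₂ : Measurable fun x : Ω × (ℕ → S.Seed) =>
      (∑ k ∈ Finset.range l, S.download n θ (x.2 k), x.1) := by
    refine Measurable.prodMk (Finset.measurable_fun_sum _ fun k _ => ?_) measurable_fst
    exact (S.measurable_download n θ).comp ((measurable_pi_apply k).comp measurable_snd)
  exact h₁.comp h₂

/-- A measurable version of the mean peak. -/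
noncomputable def peakProxy (Z : Fin N → ℕ → Ω → ℝ) (S : PIRScheme N M L) (θ : Fin M) (t : ℝ)
    (x : Ω × (ℕ → S.Seed)) : ℝ≥0∞ :=
  ∑' l : ℕ, {x | pathTime Z S θ l x ≤ t ∧ t < pathTime Z S θ (l + 1) x}.indicator
    (fun x => ENNReal.ofReal ((pathTime Z S θ l x + pathTime Z S θ (l - 1) x) / l)) x

lemma measurable_peakProxy (hZ : ∀ n i, Measurable (Z n i)) (t : ℝ) :
    Measurable (peakProxy Z S θ t) := by
  have h := measurable_pathTime (S := S) (θ := θ) hZ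
  refine Measurable.tsum fun l => Measurable.indicator ?_ ?_
  · exact (((h l).add (h (l - 1))).div_const _).ennreal_ofReal
  · exact (measurableSet_le (h l) measurable_const).inter (measurableSet_lt measurable_const (h _))

/-- Sample paths for which the law of large numbers holds. -/
def IsRegularPath (μ : Fin N → ℝ) (Z : Fin N → ℕ → Ω → ℝ) (S : PIRScheme N M L) (θ : Fin M)
    (x : Ω × (ℕ → S.Seed)) : Prop :=
  (∀ n i, 0 < Z n i x.1) ∧
  StrictMono (receiveTime (fun n j => S.download n θ (x.2 j)) (fun n i => Z n i x.1)) ∧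
  Tendsto (fun l : ℕ => receiveTime (fun n j => S.download n θ (x.2 j))
    (fun n i => Z n i x.1) l / l) atTop (nhds (∑ n, μ n * S.meanDownload n θ))

lemma ae_tendsto_download (n : Fin N) (hint : Integrable (fun f => (S.download n θ f : ℝ)) S.law) :
    ∀ᵐ g ∂(Measure.infinitePi fun _ : ℕ => S.law),
      Tendsto (fun l : ℕ => (∑ k ∈ Finset.range l, (S.download n θ (g k) : ℝ)) / l) atTop
        (nhds (S.meanDownload n θ)) := by
  have hd : Measurable fun f => (S.download n θ f : ℝ) :=
    measurable_from_top.comp (S.measurable_download n θ)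
  have hmp : ∀ k : ℕ, MeasurePreserving (Function.eval k)
      (Measure.infinitePi fun _ : ℕ => S.law) S.law :=
    fun k => measurePreserving_eval_infinitePi (fun _ : ℕ => S.law) k
  have hmap : ∀ k : ℕ, (Measure.infinitePi fun _ : ℕ => S.law).map
      (fun g => (S.download n θ (g k) : ℝ)) = S.law.map fun f => (S.download n θ f : ℝ) := by
    intro k
    conv_rhs => rw [← (hmp k).map_eq, Measure.map_map hd (hmp k).measurable]
    rfl
  have hdk : ∀ k : ℕ, Measurable fun g : ℕ → S.Seed => (S.download n θ (g k) : ℝ) :=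
    fun k => hd.comp (measurable_pi_apply k)
  have := strong_law_ae_real (μ := Measure.infinitePi fun _ : ℕ => S.law)
    (fun k g => (S.download n θ (g k) : ℝ)) ((hmp 0).integrable_comp_of_integrable hint)
    (fun i j hij => (iIndepFun_infinitePi (P := fun _ : ℕ => S.law)
      (X := fun _ f => (S.download n θ f : ℝ)) fun _ => hd).indepFun hij)
    (fun k => ⟨(hdk k).aemeasurable, (hdk 0).aemeasurable, by rw [hmap, hmap]⟩)
  have hm : ∫ g, (S.download n θ (g 0) : ℝ) ∂(Measure.infinitePi fun _ : ℕ => S.law) =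
      S.meanDownload n θ := by
    rw [PIRScheme.meanDownload]
    conv_rhs => rw [← (hmp 0).map_eq,
      integral_map (hmp 0).measurable.aemeasurable hd.aestronglyMeasurable]
  rwa [hm] at this

variable (hZ : IsDelayModel P Z μ)
  (hint : ∀ n, Integrable (fun f => (S.download n θ f : ℝ)) S.law)
  (hpos : ∀ᵐ f ∂S.law, ∃ n, 0 < S.download n θ f)

include hZ hint hpos

lemma mean_epochTime_pos : 0 < ∑ n, μ n * S.meanDownload n θ := by
  have hnn : ∀ n, 0 ≤ S.meanDownload n θ := fun n => integral_nonneg fun f => by positivity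
  by_contra hcon
  have hz : ∀ n, S.meanDownload n θ = 0 := by
    intro n
    have h0 : ∑ n, μ n * S.meanDownload n θ = 0 :=
      le_antisymm (not_lt.1 hcon) (Finset.sum_nonneg fun n _ => mul_nonneg (hZ.mean_pos n).le (hnn n))
    rw [Finset.sum_eq_zero_iff_of_nonneg fun n _ => mul_nonneg (hZ.mean_pos n).le (hnn n)] at h0
    exact (mul_eq_zero.1 (h0 n (Finset.mem_univ n))).resolve_left (hZ.mean_pos n).ne'
  have hae : ∀ᵐ f ∂S.law, ∀ n, S.download n θ f = 0 := by
    refine ae_all_iff.2 fun n => ?_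
    filter_upwards [(integral_eq_zero_iff_of_nonneg (fun f => by positivity) (hint n)).1 (hz n)]
      with f hf
    simpa using hf
  obtain ⟨f, h1, n, h2⟩ := (hae.and hpos).exists
  exact h2.ne' (h1 n)

lemma ae_isRegularPath :
    ∀ᵐ x ∂(P.prod (Measure.infinitePi fun _ : ℕ => S.law)), IsRegularPath μ Z S θ x := by
  have h₁ : ∀ᵐ ω ∂P, (∀ n i, 0 < Z n i ω) ∧ ∀ n,
      Tendsto (fun k : ℕ => (∑ i ∈ Finset.range k, Z n i ω) / k) atTop (nhds (μ n)) :=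
    hZ.ae_pos.and hZ.ae_tendsto
  have h₂ : ∀ᵐ g ∂(Measure.infinitePi fun _ : ℕ => S.law),
      (∀ j, ∃ n, 0 < S.download n θ (g j)) ∧ ∀ n,
      Tendsto (fun l : ℕ => (∑ k ∈ Finset.range l, (S.download n θ (g k) : ℝ)) / l) atTop
        (nhds (S.meanDownload n θ)) := by
    refine (ae_all_iff.2 fun j => ?_).and (ae_all_iff.2 fun n => ae_tendsto_download n (hint n))
    exact (measurePreserving_eval_infinitePi (fun _ : ℕ => S.law) j).quasiMeasurePreserving.ae hpos
  filter_upwards [Measure.quasiMeasurePreserving_fst.ae h₁,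
    Measure.quasiMeasurePreserving_snd.ae h₂] with x hx₁ hx₂
  exact ⟨hx₁.1, receiveTime_strictMono hx₁.1 hx₂.1, tendsto_receiveTime_div hx₁.2 hx₂.2⟩

omit [MeasurableSpace Ω] hint hpos hZ in
-- The intervals between consecutive receptions are disjoint and cover the times `t ≥ 0`, so exactly
-- one indicator in the series is nonzero.
lemma IsRegularPath.peakProxy_eq {x : Ω × (ℕ → S.Seed)} (hx : IsRegularPath μ Z S θ x)
    (hc : 0 < ∑ n, μ n * S.meanDownload n θ) {t : ℝ} (ht : 0 ≤ t) :
    peakProxy Z S θ t x = ENNReal.ofReal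
      (meanPeak (fun n j => S.download n θ (x.2 j)) (fun n i => Z n i x.1) t) := by
  obtain ⟨l, h₁, h₂⟩ := exists_receiveTime_le_lt (tendsto_atTop_of_tendsto_div hc hx.2.2) ht
  rw [meanPeak_eq hx.2.1 h₁ h₂, peakProxy, tsum_eq_single l]
  · rw [Set.indicator_of_mem (show x ∈ {x | pathTime Z S θ l x ≤ t ∧
      t < pathTime Z S θ (l + 1) x} from ⟨h₁, h₂⟩)]
    rfl
  · intro j hj
    refine Set.indicator_of_notMem (fun h => hj ?_) _
    have h3 : pathTime Z S θ j x ≤ t ∧ t < pathTime Z S θ (j + 1) x := h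
    rw [← numUpdates_eq hx.2.1 h₁ h₂, numUpdates_eq hx.2.1 h3.1 h3.2]

/-- Replaces an integrand built from left limits and suprema, whose measurability is not evident, by
a measurable one that agrees with it almost everywhere. -/
lemma peakAoI_eq_limsup_peakProxy : peakAoI P Z S θ =
    limsup (fun t : ℝ => ∫⁻ x, peakProxy Z S θ t x
      ∂(P.prod (Measure.infinitePi fun _ : ℕ => S.law))) atTop := by
  refine limsup_congr ?_
  filter_upwards [eventually_ge_atTop 0] with t ht
  refine lintegral_congr_ae ?_
  filter_upwards [ae_isRegularPath hZ hint hpos] with x hx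
  exact (hx.peakProxy_eq (mean_epochTime_pos hZ hint hpos) ht).symm

lemma ae_tendsto_peakProxy : ∀ᵐ x ∂(P.prod (Measure.infinitePi fun _ : ℕ => S.law)),
    Tendsto (fun t => peakProxy Z S θ t x) atTop
      (nhds (ENNReal.ofReal (2 * ∑ n, μ n * S.meanDownload n θ))) := by
  have hc := mean_epochTime_pos hZ hint hpos
  filter_upwards [ae_isRegularPath hZ hint hpos] with x hx
  refine (ENNReal.tendsto_ofReal (tendsto_meanPeak hc hx.2.1 hx.2.2)).congr' ?_
  filter_upwards [eventually_ge_atTop 0] with t ht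
  exact (hx.peakProxy_eq hc ht).symm

/-- The peak age is at least twice the mean epoch time. -/
theorem le_peakAoI :
    ENNReal.ofReal (2 * ∑ n, μ n * S.meanDownload n θ) ≤ peakAoI P Z S θ := by
  rw [peakAoI_eq_limsup_peakProxy hZ hint hpos]
  set ν := P.prod (Measure.infinitePi fun _ : ℕ => S.law)
  have hν : ν Set.univ = 1 := measure_univ
  -- Fatou's lemma along integer times; with unbounded download sizes the dominating function used
  -- for equality is not available.
  calc ENNReal.ofReal (2 * ∑ n, μ n * S.meanDownload n θ)
      = ∫⁻ _, ENNReal.ofReal (2 * ∑ n, μ n * S.meanDownload n θ) ∂ν := by simp [hν]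
    _ = ∫⁻ x, liminf (fun k : ℕ => peakProxy Z S θ (k : ℝ) x) atTop ∂ν := by
        refine lintegral_congr_ae ?_
        filter_upwards [ae_tendsto_peakProxy hZ hint hpos] with x hx
        exact (hx.comp tendsto_natCast_atTop_atTop).liminf_eq.symm
    _ ≤ liminf (fun k : ℕ => ∫⁻ x, peakProxy Z S θ (k : ℝ) x ∂ν) atTop :=
        lintegral_liminf_le fun k => measurable_peakProxy hZ.meas k
    _ ≤ limsup (fun k : ℕ => ∫⁻ x, peakProxy Z S θ (k : ℝ) x ∂ν) atTop := liminf_le_limsup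
    _ ≤ limsup (fun t : ℝ => ∫⁻ x, peakProxy Z S θ t x ∂ν) atTop := by
        have := limsup_le_limsup_of_le (f := map (fun k : ℕ => (k : ℝ)) atTop) (g := atTop)
          (u := fun t : ℝ => ∫⁻ x, peakProxy Z S θ t x ∂ν) tendsto_natCast_atTop_atTop
        exact this

omit [MeasurableSpace Ω] hZ hint hpos in
-- The first `l` epochs use at most `l * B` delays of each server and the numerator of the mean peak
-- is at most twice the last reception time, so empirical means of `l * B` delays dominate uniformly
-- in `t`.
lemma IsRegularPath.peakProxy_le {x : Ω × (ℕ → S.Seed)} (hx : IsRegularPath μ Z S θ x)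
    (hc : 0 < ∑ n, μ n * S.meanDownload n θ) {t : ℝ} (ht : 0 ≤ t) (hμ : ∀ n, 0 ≤ μ n) {B : ℕ}
    (hB : ∀ n f, S.download n θ f ≤ B) :
    peakProxy Z S θ t x ≤ ∑ n, ENNReal.ofReal (2 * B) * dyadicBound (μ n) fun i => Z n i x.1 := by
  rw [hx.peakProxy_eq hc ht]
  obtain ⟨l, h₁, h₂⟩ := exists_receiveTime_le_lt (tendsto_atTop_of_tendsto_div hc hx.2.2) ht
  rw [meanPeak_eq hx.2.1 h₁ h₂]
  set d : Fin N → ℕ → ℕ := fun n j => S.download n θ (x.2 j) with hd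
  set z : Fin N → ℕ → ℝ := fun n i => Z n i x.1 with hzdef
  have hz : ∀ n i, 0 < z n i := hx.1
  have hle : (receiveTime d z l + receiveTime d z (l - 1)) / l ≤
      ∑ n, (2 * B : ℝ) * ((∑ i ∈ Finset.range (l * B), z n i) / (l * B : ℕ)) := by
    have e1 : receiveTime d z (l - 1) ≤ receiveTime d z l := hx.2.1.monotone (Nat.sub_le _ _)
    have e2 : receiveTime d z l ≤ ∑ n, ∑ i ∈ Finset.range (l * B), z n i := by
      rw [receiveTime_eq]
      refine Finset.sum_le_sum fun n _ => Finset.sum_le_sum_of_subset_of_nonneg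
        (Finset.range_mono ?_) fun i _ _ => (hz n i).le
      have := Finset.sum_le_card_nsmul (Finset.range l) (d n) B fun k _ => hB n _
      simpa using this
    calc (receiveTime d z l + receiveTime d z (l - 1)) / l
        ≤ (2 * ∑ n, ∑ i ∈ Finset.range (l * B), z n i) / l := by gcongr; linarith
      _ = ∑ n, (2 * B : ℝ) * ((∑ i ∈ Finset.range (l * B), z n i) / (l * B : ℕ)) := by
        rw [Finset.mul_sum, Finset.sum_div]
        refine Finset.sum_congr rfl fun n _ => ?_
        rcases Nat.eq_zero_or_pos B with rfl | hB0
        · simp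
        · have : (B : ℝ) ≠ 0 := by positivity
          push_cast
          rcases Nat.eq_zero_or_pos l with rfl | hl0
          · simp
          · have : (l : ℝ) ≠ 0 := by positivity
            field_simp
  refine (ENNReal.ofReal_le_ofReal hle).trans ?_
  rw [ENNReal.ofReal_sum_of_nonneg fun n _ => mul_nonneg (by positivity)
    (div_nonneg (Finset.sum_nonneg fun i _ => (hz n i).le) (by positivity))]
  refine Finset.sum_le_sum fun n _ => ?_
  rw [ENNReal.ofReal_mul (by positivity)]
  gcongr
  exact ofReal_mean_le_dyadicBound (hμ n) (fun i => (hz n i).le) _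

/-- The peak age of a scheme with bounded download sizes is twice the mean epoch time. -/
theorem peakAoI_eq {B : ℕ} (hB : ∀ n f, S.download n θ f ≤ B) :
    peakAoI P Z S θ = ENNReal.ofReal (2 * ∑ n, μ n * S.meanDownload n θ) := by
  rw [peakAoI_eq_limsup_peakProxy hZ hint hpos]
  have hc := mean_epochTime_pos hZ hint hpos
  set ν := P.prod (Measure.infinitePi fun _ : ℕ => S.law) with hνdef
  have hν : ν Set.univ = 1 := measure_univ
  have hlim := tendsto_lintegral_filter_of_dominated_convergence (μ := ν) (l := atTop)
    (F := fun t : ℝ => peakProxy Z S θ t)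
    (f := fun _ => ENNReal.ofReal (2 * ∑ n, μ n * S.meanDownload n θ))
    (fun x => ∑ n, ENNReal.ofReal (2 * B) * dyadicBound (μ n) fun i => Z n i x.1)
    (Eventually.of_forall fun t => measurable_peakProxy hZ.meas t)
    (by
      filter_upwards [eventually_ge_atTop 0] with t ht
      filter_upwards [ae_isRegularPath hZ hint hpos] with x hx
      exact hx.peakProxy_le hc ht (fun n => (hZ.mean_pos n).le) hB)
    (by
      have hm : Measurable fun ω => ∑ n, ENNReal.ofReal (2 * B) *
          dyadicBound (μ n) fun i => Z n i ω :=
        Finset.measurable_fun_sum _ fun n _ => (hZ.measurable_dyadicBound n).const_mul _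
      have e := (measurePreserving_fst (μ := P)
        (ν := Measure.infinitePi fun _ : ℕ => S.law)).lintegral_comp hm
      rw [← hνdef] at e
      rw [e, lintegral_finsetSum _ fun n _ => (hZ.measurable_dyadicBound n).const_mul _]
      refine (ENNReal.sum_lt_top.2 fun n _ => ?_).ne
      rw [lintegral_const_mul _ (hZ.measurable_dyadicBound n)]
      exact ENNReal.mul_lt_top ENNReal.ofReal_lt_top (hZ.lintegral_dyadicBound_ne_top n).lt_top)
    (ae_tendsto_peakProxy hZ hint hpos)
  rw [hlim.limsup_eq]
  simp [hν]

end Peak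

/-! ### Converse

The information content of an answer given some of the messages is measured by the average
logarithm of the number of its possible values. -/

section Information

variable {M L : ℕ} {α β : Type*} [DecidableEq α] [DecidableEq β]

/-- Libraries that agree with `W` on the messages in `s`. -/
def agreeing (s : Finset (Fin M)) (W : Library M L) : Finset (Library M L) :=
  Finset.univ.filter fun W' => ∀ m ∈ s, W' m = W m

/-- Number of values of `A` that are possible given the messages of `W` in `s`. -/
def valueCount (A : Library M L → α) (s : Finset (Fin M)) (W : Library M L) : ℕ :=
  ((agreeing s W).image A).card

/-- Average number of bits needed to describe `A` given the messages in `s`. -/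
noncomputable def condInfo (A : Library M L → α) (s : Finset (Fin M)) : ℝ :=
  (∑ W : Library M L, Real.logb 2 (valueCount A s W)) / Fintype.card (Library M L)

lemma self_mem_agreeing (s : Finset (Fin M)) (W : Library M L) : W ∈ agreeing s W := by
  simp [agreeing]

lemma valueCount_pos (A : Library M L → α) (s : Finset (Fin M)) (W : Library M L) :
    0 < valueCount A s W :=
  Finset.card_pos.2 ⟨A W, Finset.mem_image_of_mem _ (self_mem_agreeing s W)⟩

lemma logb_valueCount_nonneg (A : Library M L → α) (s : Finset (Fin M)) (W : Library M L) :
    0 ≤ Real.logb 2 (valueCount A s W) :=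
  Real.logb_nonneg one_lt_two (by exact_mod_cast valueCount_pos A s W)

lemma condInfo_nonneg (A : Library M L → α) (s : Finset (Fin M)) : 0 ≤ condInfo A s :=
  div_nonneg (Finset.sum_nonneg fun W _ => logb_valueCount_nonneg A s W) (by positivity)

lemma condInfo_comp_le (A : Library M L → α) (g : α → β) (s : Finset (Fin M)) :
    condInfo (fun W => g (A W)) s ≤ condInfo A s := by
  refine div_le_div_of_nonneg_right (Finset.sum_le_sum fun W _ => ?_) (by positivity)
  refine Real.logb_le_logb_of_le one_lt_two (by exact_mod_cast valueCount_pos _ s W) ?_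
  have : (agreeing s W).image (fun W => g (A W)) = ((agreeing s W).image A).image g := by
    rw [Finset.image_image]; rfl
  rw [valueCount, this]
  exact_mod_cast Finset.card_image_le

lemma condInfo_prod_le (A : Library M L → α) (B : Library M L → β) (s : Finset (Fin M)) :
    condInfo (fun W => (A W, B W)) s ≤ condInfo A s + condInfo B s := by
  rw [condInfo, condInfo, condInfo, ← add_div, ← Finset.sum_add_distrib]
  refine div_le_div_of_nonneg_right (Finset.sum_le_sum fun W _ => ?_) (by positivity)
  have hA : (valueCount A s W : ℝ) ≠ 0 := by exact_mod_cast (valueCount_pos A s W).ne'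
  have hB : (valueCount B s W : ℝ) ≠ 0 := by exact_mod_cast (valueCount_pos B s W).ne'
  rw [← Real.logb_mul hA hB]
  refine Real.logb_le_logb_of_le one_lt_two (by exact_mod_cast valueCount_pos _ s W) ?_
  have hsub : (agreeing s W).image (fun W => (A W, B W)) ⊆
      (agreeing s W).image A ×ˢ (agreeing s W).image B := by
    intro p hp
    obtain ⟨W', hW', rfl⟩ := Finset.mem_image.1 hp
    exact Finset.mem_product.2 ⟨Finset.mem_image_of_mem _ hW', Finset.mem_image_of_mem _ hW'⟩
  have := Finset.card_le_card hsub
  rw [Finset.card_product] at this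
  exact_mod_cast this

lemma condInfo_le_length {A : Library M L → List Bool} {d : ℕ} (hA : ∀ W, (A W).length = d)
    (s : Finset (Fin M)) : condInfo A s ≤ d := by
  have hcard : (0 : ℝ) < Fintype.card (Library M L) := by exact_mod_cast Fintype.card_pos
  rw [condInfo, div_le_iff₀ hcard]
  calc ∑ W : Library M L, Real.logb 2 (valueCount A s W) ≤ ∑ _W : Library M L, (d : ℝ) := by
        refine Finset.sum_le_sum fun W _ => ?_
        have hsub : (agreeing s W).image A ⊆
            (Finset.univ : Finset (List.Vector Bool d)).image List.Vector.toList := by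
          intro a ha
          obtain ⟨W', -, rfl⟩ := Finset.mem_image.1 ha
          exact Finset.mem_image.2 ⟨⟨A W', hA W'⟩, Finset.mem_univ _, rfl⟩
        have hle : valueCount A s W ≤ 2 ^ d := by
          refine (Finset.card_le_card hsub).trans (Finset.card_image_le.trans ?_)
          simp [card_vector]
        rw [Real.logb_le_iff_le_rpow one_lt_two (by exact_mod_cast valueCount_pos A s W),
          Real.rpow_natCast]
        exact_mod_cast hle
    _ = d * Fintype.card (Library M L) := by simp [mul_comm]

/-- If `A` determines message `θ`, its values split according to the value of that message. -/
lemma valueCount_eq_sum {A : Library M L → α} {θ : Fin M} {s : Finset (Fin M)} (hθ : θ ∉ s)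
    (hdec : ∀ W W', A W = A W' → W θ = W' θ) (W : Library M L) :
    valueCount A s W =
      ∑ v : Fin L → Bool, valueCount A (insert θ s) (Function.update W θ v) := by
  have e : (agreeing s W).image A = (Finset.univ : Finset (Fin L → Bool)).biUnion
      fun v => (agreeing (insert θ s) (Function.update W θ v)).image A := by
    ext a
    simp only [Finset.mem_image, Finset.mem_biUnion, Finset.mem_univ, true_and, agreeing,
      Finset.mem_filter, Finset.mem_insert, forall_eq_or_imp, Function.update_self]
    constructor
    · rintro ⟨W', hW', rfl⟩
      refine ⟨W' θ, W', ⟨rfl, fun m hm => ?_⟩, rfl⟩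
      rw [Function.update_of_ne (ne_of_mem_of_not_mem hm hθ), hW' m hm]
    · rintro ⟨v, W', ⟨-, hW'⟩, rfl⟩
      refine ⟨W', fun m hm => ?_, rfl⟩
      rw [hW' m hm, Function.update_of_ne (ne_of_mem_of_not_mem hm hθ)]
  rw [valueCount, e, Finset.card_biUnion]
  · rfl
  · intro v _ v' _ hne
    refine Finset.disjoint_left.2 fun a ha ha' => hne ?_
    simp only [Finset.mem_image, agreeing, Finset.mem_filter, Finset.mem_univ, true_and,
      Finset.mem_insert, forall_eq_or_imp, Function.update_self] at ha ha'
    obtain ⟨U, ⟨hU, -⟩, rfl⟩ := ha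
    obtain ⟨U', ⟨hU', -⟩, hUU'⟩ := ha'
    rw [← hU, ← hU']
    exact hdec _ _ hUU'.symm

/-- Averaging over one message and then over the library. -/
lemma sum_sum_update (F : Library M L → ℝ) (θ : Fin M) :
    ∑ W : Library M L, ∑ v : Fin L → Bool, F (Function.update W θ v) =
      2 ^ L * ∑ W : Library M L, F W := by
  -- Exchanging message `θ` with `v` permutes the pairs `(W, v)`; afterwards the summand no longer
  -- depends on `v`, whence the factor `2 ^ L`.
  have hinv : Function.Involutive fun p : Library M L × (Fin L → Bool) =>
      (Function.update p.1 θ p.2, p.1 θ) := by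
    rintro ⟨W, v⟩
    simp
  have h := Equiv.sum_comp hinv.toPerm fun p => F p.1
  simp only [Function.Involutive.coe_toPerm] at h
  rw [Fintype.sum_prod_type, Fintype.sum_prod_type] at h
  rw [h, Finset.mul_sum]
  simp

/-- Jensen's inequality for the concave logarithm with equal weights. -/
lemma logb_sum_ge {ι : Type*} [Fintype ι] [Nonempty ι] {r : ι → ℝ} (hr : ∀ i, 0 < r i) :
    Real.logb 2 (Fintype.card ι) + (∑ i, Real.logb 2 (r i)) / Fintype.card ι ≤
      Real.logb 2 (∑ i, r i) := by
  have hc : (0 : ℝ) < Fintype.card ι := by exact_mod_cast Fintype.card_pos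
  have hs : 0 < ∑ i, r i := Finset.sum_pos (fun i _ => hr i) Finset.univ_nonempty
  have hlog2 : 0 < Real.log 2 := Real.log_pos one_lt_two
  have hj := strictConcaveOn_log_Ioi.concaveOn.le_map_sum (t := Finset.univ)
    (w := fun _ : ι => 1 / (Fintype.card ι : ℝ)) (p := r) (fun i _ => by positivity)
    (by simp) (fun i _ => hr i)
  simp only [smul_eq_mul, ← Finset.mul_sum] at hj
  rw [Real.log_mul (by positivity) hs.ne', Real.log_div one_ne_zero hc.ne', Real.log_one] at hj
  simp only [Real.logb, ← Finset.sum_div]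
  rw [div_div, mul_comm, ← div_div, ← add_div, div_le_div_iff_of_pos_right hlog2]
  rw [one_div, inv_mul_eq_div] at hj
  linarith

/-- Chain rule: an answer that determines message `θ` contains its `L` bits. -/
lemma add_condInfo_insert_le {A : Library M L → α} {θ : Fin M} {s : Finset (Fin M)}
    (hθ : θ ∉ s) (hdec : ∀ W W', A W = A W' → W θ = W' θ) :
    L + condInfo A (insert θ s) ≤ condInfo A s := by
  have hcard : (0 : ℝ) < Fintype.card (Library M L) := by exact_mod_cast Fintype.card_pos
  have hW : ∀ W : Library M L, L + (∑ v : Fin L → Bool,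
      Real.logb 2 (valueCount A (insert θ s) (Function.update W θ v))) / 2 ^ L ≤
      Real.logb 2 (valueCount A s W) := by
    intro W
    have h := logb_sum_ge (r := fun v : Fin L → Bool =>
      (valueCount A (insert θ s) (Function.update W θ v) : ℝ))
      fun v => by exact_mod_cast valueCount_pos _ _ _
    rw [valueCount_eq_sum hθ hdec W]
    push_cast
    simpa [Real.logb_pow] using h
  have hsum := Finset.sum_le_sum fun W (_ : W ∈ Finset.univ) => hW W
  rw [Finset.sum_add_distrib, ← Finset.sum_div,
    sum_sum_update (fun W => Real.logb 2 (valueCount A (insert θ s) W)) θ] at hsum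
  rw [mul_div_cancel_left₀ _ (by positivity : (2 ^ L : ℝ) ≠ 0), Finset.sum_const, Finset.card_univ,
    nsmul_eq_mul] at hsum
  rw [condInfo, condInfo, le_div_iff₀ hcard, add_mul, div_mul_cancel₀ _ hcard.ne']
  linarith

end Information

/-! ### Information bounds for correct and private schemes -/

namespace PIRScheme

variable {M L : ℕ}

/-- Two-server chain rule for the answers to the queries of one epoch. -/
lemma add_condInfo_answer_le {S : PIRScheme 2 M L} {θ : Fin M} {f : S.Seed} (n : Fin 2)
    (hf : ∀ W : Library M L,
      S.decode θ (fun n => S.query n θ f) (fun n => S.answer n (S.query n θ f) W) = W θ)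
    {s : Finset (Fin M)} (hθ : θ ∉ s) :
    L + condInfo (S.answer n (S.query n θ f)) (insert θ s) ≤
      condInfo (S.answer 0 (S.query 0 θ f)) s + condInfo (S.answer 1 (S.query 1 θ f)) s := by
  set A : Library M L → List Bool × List Bool :=
    fun W => (S.answer 0 (S.query 0 θ f) W, S.answer 1 (S.query 1 θ f) W) with hA
  have hdec : ∀ W W', A W = A W' → W θ = W' θ := by
    intro W W' h
    rw [← hf W, ← hf W']
    congr 1
    funext n
    fin_cases n
    · exact congrArg Prod.fst h
    · exact congrArg Prod.snd h
  have hn : condInfo (S.answer n (S.query n θ f)) (insert θ s) ≤ condInfo A (insert θ s) := by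
    fin_cases n
    · exact condInfo_comp_le A Prod.fst _
    · exact condInfo_comp_le A Prod.snd _
  linarith [add_condInfo_insert_le hθ hdec,
    condInfo_prod_le (S.answer 0 (S.query 0 θ f)) (S.answer 1 (S.query 1 θ f)) s]

lemma condInfo_answer_le {N : ℕ} (S : PIRScheme N M L) (n : Fin N) (q : List Bool)
    (s : Finset (Fin M)) : condInfo (S.answer n q) s ≤ S.size n q :=
  condInfo_le_length (fun W => S.answer_length n q W) s

/-- Functions of a single query have the same mean for all desired messages. -/
lemma IsPrivate.integral_eq {N : ℕ} {S : PIRScheme N M L} (hS : S.IsPrivate) (n : Fin N)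
    (θ θ' : Fin M) (g : List Bool → ℝ) :
    ∫ f, g (S.query n θ f) ∂S.law = ∫ f, g (S.query n θ' f) ∂S.law := by
  let _ : MeasurableSpace (List Bool) := ⊤
  have hq : ∀ θ, Measurable (S.query n θ) := fun θ => S.measurable_query_comp n θ id
  have hmap : S.law.map (S.query n θ) = S.law.map (S.query n θ') := by
    refine Measure.ext_of_singleton fun q => ?_
    rw [Measure.map_apply (hq θ) trivial, Measure.map_apply (hq θ') trivial]
    exact hS n θ θ' q
  have hg : ∀ ν : Measure (List Bool), AEStronglyMeasurable g ν := fun ν =>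
    (measurable_from_top (f := g)).aestronglyMeasurable
  rw [← integral_map (hq θ).aemeasurable (hg _), hmap, integral_map (hq θ').aemeasurable (hg _)]

/-- Average information content of the answer of server `n` given the messages in `s`. -/
noncomputable def meanInfo {N : ℕ} (S : PIRScheme N M L) (n : Fin N) (θ : Fin M)
    (s : Finset (Fin M)) : ℝ :=
  ∫ f, condInfo (S.answer n (S.query n θ f)) s ∂S.law

lemma integrable_condInfo {N : ℕ} {S : PIRScheme N M L} {n : Fin N} {θ : Fin M}
    (hint : Integrable (fun f => (S.download n θ f : ℝ)) S.law) (s : Finset (Fin M)) :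
    Integrable (fun f => condInfo (S.answer n (S.query n θ f)) s) S.law := by
  refine hint.mono' (S.measurable_query_comp n θ fun q =>
    condInfo (S.answer n q) s).aestronglyMeasurable (Eventually.of_forall fun f => ?_)
  rw [Real.norm_of_nonneg (condInfo_nonneg _ _)]
  exact S.condInfo_answer_le n _ s

lemma meanInfo_le {N : ℕ} {S : PIRScheme N M L} {n : Fin N} {θ : Fin M}
    (hint : Integrable (fun f => (S.download n θ f : ℝ)) S.law) (s : Finset (Fin M)) :
    S.meanInfo n θ s ≤ S.meanDownload n θ :=
  integral_mono (integrable_condInfo hint s) hint fun _ => S.condInfo_answer_le n _ s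

lemma meanInfo_nonneg {N : ℕ} (S : PIRScheme N M L) (n : Fin N) (θ : Fin M)
    (s : Finset (Fin M)) : 0 ≤ S.meanInfo n θ s :=
  integral_nonneg fun _ => condInfo_nonneg _ _

variable {S : PIRScheme 2 M L}

lemma IsCorrect.add_meanInfo_le (hS : S.IsCorrect) {θ : Fin M}
    (hint : ∀ n, Integrable (fun f => (S.download n θ f : ℝ)) S.law) (n : Fin 2)
    {s : Finset (Fin M)} (hθ : θ ∉ s) :
    L + S.meanInfo n θ (insert θ s) ≤ S.meanInfo 0 θ s + S.meanInfo 1 θ s := by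
  have hI := fun n s => integrable_condInfo (hint n) s
  have h : ∫ f, ((L : ℝ) + condInfo (S.answer n (S.query n θ f)) (insert θ s)) ∂S.law ≤
      ∫ f, (condInfo (S.answer 0 (S.query 0 θ f)) s +
        condInfo (S.answer 1 (S.query 1 θ f)) s) ∂S.law := by
    refine integral_mono_ae ((integrable_const _).add (hI n _)) ((hI 0 s).add (hI 1 s)) ?_
    filter_upwards [hS θ] with f hf
    exact add_condInfo_answer_le n hf hθ
  rw [integral_add (integrable_const _) (hI n _), integral_add (hI 0 s) (hI 1 s)] at h
  simpa [meanInfo] using h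

/-- The answers must carry the `L` bits of the desired message, so almost surely they are not both
empty. This makes reception times strictly increasing. -/
lemma IsCorrect.ae_download_pos (hS : S.IsCorrect) (hL : 0 < L) (θ : Fin M) :
    ∀ᵐ f ∂S.law, ∃ n, 0 < S.download n θ f := by
  filter_upwards [hS θ] with f hf
  have h := add_condInfo_answer_le 0 hf (Finset.notMem_empty θ)
  have h0 := S.condInfo_answer_le 0 (S.query 0 θ f) ∅
  have h1 := S.condInfo_answer_le 1 (S.query 1 θ f) ∅
  have hL' : (0 : ℝ) < L := by exact_mod_cast hL
  have hn := condInfo_nonneg (S.answer 0 (S.query 0 θ f)) (insert θ ∅)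
  have : (0 : ℝ) < (S.download 0 θ f : ℝ) + S.download 1 θ f := by
    unfold download
    linarith
  by_contra hcon
  push Not at hcon
  simp [Nat.le_zero.1 (hcon 0), Nat.le_zero.1 (hcon 1)] at this

/-- Converse bounds on the mean download sizes for three messages on two servers. -/
theorem meanDownload_bounds {S : PIRScheme 2 3 L} (hc : S.IsCorrect) (hp : S.IsPrivate)
    (hint : ∀ n θ, Integrable (fun f => (S.download n θ f : ℝ)) S.law) (θ : Fin 3) :
    7 / 4 * (L : ℝ) ≤ ∑ n, S.meanDownload n θ ∧
    ∀ n, max (3 / 2 * (L : ℝ) - 1 / 2 * ∑ n, S.meanDownload n θ)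
      (5 / 2 * (L : ℝ) - ∑ n, S.meanDownload n θ) ≤ S.meanDownload n θ := by
  have hI : ∀ n θ' s, S.meanInfo n θ' s = S.meanInfo n θ s := fun n θ' s =>
    hp.integral_eq n θ' θ fun q => condInfo (S.answer n q) s
  have hle : ∀ n s, S.meanInfo n θ s ≤ S.meanDownload n θ := fun n s => meanInfo_le (hint n θ) s
  -- The chain rule is used three times, for desired messages 0, 1, 2 given none, the first, and the
  -- first two; `hI` then moves all averages to the common index `θ`.
  have h₁ : ∀ n, (L : ℝ) + S.meanInfo n θ {0} ≤ S.meanDownload 0 θ + S.meanDownload 1 θ := by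
    intro n
    have := hc.add_meanInfo_le (fun n => hint n 0) n (Finset.notMem_empty (0 : Fin 3))
    rw [hI n 0, hI 0 0, hI 1 0, insert_empty_eq] at this
    exact this.trans (add_le_add (hle 0 ∅) (hle 1 ∅))
  have h₂ : ∀ n, (L : ℝ) + S.meanInfo n θ {1, 0} ≤ S.meanInfo 0 θ {0} + S.meanInfo 1 θ {0} := by
    intro n
    have := hc.add_meanInfo_le (fun n => hint n 1) n (s := {0}) (by decide)
    rwa [hI n 1, hI 0 1, hI 1 1] at this
  have h₃ : (L : ℝ) ≤ S.meanInfo 0 θ {1, 0} + S.meanInfo 1 θ {1, 0} := by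
    have := hc.add_meanInfo_le (fun n => hint n 2) 0 (s := {1, 0}) (by decide)
    rw [hI 0 2, hI 0 2, hI 1 2] at this
    linarith [S.meanInfo_nonneg 0 θ (insert 2 {1, 0})]
  have h10 := h₁ 0
  have h11 := h₁ 1
  have h20 := h₂ 0
  have h21 := h₂ 1
  have a0 := hle 0 {0}
  have a1 := hle 1 {0}
  have b0 := hle 0 {1, 0}
  have b1 := hle 1 {1, 0}
  simp only [Fin.sum_univ_two, max_le_iff, Fin.forall_fin_two]
  -- Write `I n s` for the averages. Averaging `h₂` over `n` and using `h₃` gives `I 0 {0} + I 1 {0}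
  -- ≥ 3 / 2 * L`. With `h₁` averaged this yields `D ≥ 7 / 4 * L`; with `h₁` for the other server it
  -- yields `d n ≥ 5 / 2 * L - D`. The remaining bound comes from `2 * d n ≥ I n {0} + I n {1, 0}`,
  -- where `h₂` and `h₁` for the other server bound `I n {0}` below, and then `h₃` applies.
  refine ⟨by linarith, ⟨by linarith, by linarith⟩, by linarith, by linarith⟩

end PIRScheme

/-! ### Rates and mean download sizes -/

namespace PIRScheme

variable {N M L : ℕ}

lemma measurable_download_ennreal (S : PIRScheme N M L) (n : Fin N) (θ : Fin M) :
    Measurable fun f => (S.download n θ f : ℝ≥0∞) :=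
  measurable_from_top.comp (S.measurable_download n θ)

lemma meanDownload_nonneg (S : PIRScheme N M L) (n : Fin N) (θ : Fin M) :
    0 ≤ S.meanDownload n θ :=
  integral_nonneg fun f => by positivity

lemma expectedDownload_eq (S : PIRScheme N M L) (θ : Fin M)
    (hint : ∀ n, Integrable (fun f => (S.download n θ f : ℝ)) S.law) :
    S.expectedDownload θ = ENNReal.ofReal (∑ n, S.meanDownload n θ) := by
  rw [expectedDownload, lintegral_finsetSum _ fun n _ => S.measurable_download_ennreal n θ,
    ENNReal.ofReal_sum_of_nonneg fun n _ => S.meanDownload_nonneg n θ]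
  refine Finset.sum_congr rfl fun n _ => ?_
  rw [meanDownload, ofReal_integral_eq_lintegral_ofReal (hint n)
    (Eventually.of_forall fun f => by positivity)]
  simp

lemma integrable_download_of_bounded (S : PIRScheme N M L) (n : Fin N) (θ : Fin M) {B : ℕ}
    (hB : ∀ f, S.download n θ f ≤ B) : Integrable (fun f => (S.download n θ f : ℝ)) S.law := by
  refine Integrable.of_bound (measurable_from_top.comp
    (S.measurable_download n θ)).aestronglyMeasurable (B : ℝ) (Eventually.of_forall fun f => ?_)
  rw [Real.norm_of_nonneg (by positivity)]
  exact_mod_cast hB f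

lemma feasible_of_meanDownload {S : PIRScheme N M L} (hc : S.IsCorrect) (hp : S.IsPrivate)
    (hint : ∀ n θ, Integrable (fun f => (S.download n θ f : ℝ)) S.law) {R : ℝ} (hR : 0 < R)
    (hL : 0 < L) (hD : ∀ θ, ∑ n, S.meanDownload n θ ≤ L / R) : S.Feasible R := by
  refine ⟨hc, hp, fun θ => ?_⟩
  rw [rate, S.expectedDownload_eq θ fun n => hint n θ]
  rw [ENNReal.le_div_iff_mul_le (Or.inr (by simpa using hL.ne')) (Or.inl ENNReal.ofReal_ne_top),
    ← ENNReal.ofReal_mul hR.le]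
  refine (ENNReal.ofReal_le_ofReal ?_).trans (ENNReal.ofReal_natCast L).le
  have := mul_le_mul_of_nonneg_left (hD θ) hR.le
  rwa [mul_div_cancel₀ _ hR.ne'] at this

/-- An infinite expected download would have rate `L / ∞ = 0 < R`. -/
lemma Feasible.integrable {S : PIRScheme N M L} {R : ℝ} (hS : S.Feasible R) (hR : 0 < R)
    (n : Fin N) (θ : Fin M) : Integrable (fun f => (S.download n θ f : ℝ)) S.law := by
  have hfin : S.expectedDownload θ ≠ ∞ := by
    intro h
    have := hS.2.2 θ
    rw [rate, h, ENNReal.div_top, nonpos_iff_eq_zero, ENNReal.ofReal_eq_zero] at this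
    exact this.not_gt hR
  refine ⟨(measurable_from_top.comp (S.measurable_download n θ)).aestronglyMeasurable, ?_⟩
  refine lt_of_le_of_lt ?_ hfin.lt_top
  refine lintegral_mono fun f => ?_
  rw [Real.enorm_of_nonneg (Nat.cast_nonneg _), ENNReal.ofReal_natCast]
  exact Finset.single_le_sum (f := fun n => (S.download n θ f : ℝ≥0∞)) (fun _ _ => zero_le)
    (Finset.mem_univ n)

lemma Feasible.sum_meanDownload_le {S : PIRScheme N M L} {R : ℝ} (hS : S.Feasible R) (hR : 0 < R)
    (hL : 0 < L) (θ : Fin M) : ∑ n, S.meanDownload n θ ≤ L / R := by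
  have h := hS.2.2 θ
  rw [rate, S.expectedDownload_eq θ fun n => hS.integrable hR n θ,
    ENNReal.le_div_iff_mul_le (Or.inr (by simpa using hL.ne')) (Or.inl ENNReal.ofReal_ne_top),
    ← ENNReal.ofReal_mul hR.le, ← ENNReal.ofReal_natCast, ENNReal.ofReal_le_ofReal_iff
      (by positivity)] at h
  rwa [le_div_iff₀ hR, mul_comm]

lemma Feasible.mono {S : PIRScheme N M L} {R R' : ℝ} (hS : S.Feasible R') (h : R ≤ R') :
    S.Feasible R :=
  ⟨hS.1, hS.2.1, fun θ => (ENNReal.ofReal_le_ofReal h).trans (hS.2.2 θ)⟩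

lemma HasSizes.meanDownload_eq {S : PIRScheme N M L} {d : Fin N → ℕ} (hS : S.HasSizes d)
    (n : Fin N) (θ : Fin M) : S.meanDownload n θ = d n := by
  simp [meanDownload, hS n θ]

/-! ### Time sharing -/

lemma integral_coin (p : unitInterval) (g : Bool → ℝ) :
    ∫ b, g b ∂(coin p) = p * g true + (1 - p) * g false := by
  have h0 : (0 : ℝ) ≤ p := p.2.1
  have h1 : (0 : ℝ) ≤ 1 - p := by linarith [p.2.2]
  rw [coin, integral_add_measure ((integrable_dirac (by simp)).smul_measure (by simp))
    ((integrable_dirac (by simp)).smul_measure (by simp)),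
    integral_smul_measure, integral_smul_measure, integral_dirac, integral_dirac,
    ENNReal.toReal_ofReal h0, ENNReal.toReal_ofReal h1, smul_eq_mul, smul_eq_mul]

variable {S S' : PIRScheme N M L}

lemma timeShare_download (p : unitInterval) {d d' : Fin N → ℕ} (hS : S.HasSizes d)
    (hS' : S'.HasSizes d') (n : Fin N) (θ : Fin M) (f : (timeShare p S S').Seed) :
    (timeShare p S S').download n θ f = if f.1 then d n else d' n := by
  obtain ⟨b, f, f'⟩ := f
  cases b
  · exact hS' n θ f'
  · exact hS n θ f

lemma timeShare_meanDownload (p : unitInterval) {d d' : Fin N → ℕ} (hS : S.HasSizes d)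
    (hS' : S'.HasSizes d') (n : Fin N) (θ : Fin M) :
    (timeShare p S S').meanDownload n θ = p * d n + (1 - p) * d' n := by
  rw [meanDownload]
  simp only [timeShare_download p hS hS']
  have h := (measurePreserving_fst (μ := coin p) (ν := S.law.prod S'.law)).map_eq
  have h2 := integral_map (μ := (coin p).prod (S.law.prod S'.law)) (φ := Prod.fst)
    measurable_fst.aemeasurable
    (f := fun b : Bool => ((if b then d n else d' n : ℕ) : ℝ))
    (measurable_of_finite _).aestronglyMeasurable
  rw [h, integral_coin] at h2
  simp only [if_true, Bool.false_eq_true, if_false] at h2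
  exact h2.symm

lemma timeShare_download_le (p : unitInterval) {d d' : Fin N → ℕ} (hS : S.HasSizes d)
    (hS' : S'.HasSizes d') (n : Fin N) (θ : Fin M) (f : (timeShare p S S').Seed) :
    (timeShare p S S').download n θ f ≤ ∑ n, (d n + d' n) := by
  have h := Finset.single_le_sum (f := fun n => d n + d' n) (fun _ _ => Nat.zero_le _)
    (Finset.mem_univ n)
  rw [timeShare_download p hS hS']
  split_ifs <;> omega

/-- The decoder reads the coin from the first bits of the queries; without any server its test would
hold vacuously, hence `NeZero N`. -/
lemma IsCorrect.timeShare [NeZero N] (p : unitInterval) (hS : S.IsCorrect) (hS' : S'.IsCorrect) :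
    (timeShare p S S').IsCorrect := by
  intro θ
  have h₁ : ∀ᵐ f ∂((coin p).prod (S.law.prod S'.law)), ∀ W : Library M L,
      S.decode θ (fun n => S.query n θ f.2.1) (fun n => S.answer n (S.query n θ f.2.1) W) = W θ :=
    Measure.quasiMeasurePreserving_snd.ae (Measure.quasiMeasurePreserving_fst.ae (hS θ))
  have h₂ : ∀ᵐ f ∂((coin p).prod (S.law.prod S'.law)), ∀ W : Library M L,
      S'.decode θ (fun n => S'.query n θ f.2.2) (fun n => S'.answer n (S'.query n θ f.2.2) W) =
        W θ :=
    Measure.quasiMeasurePreserving_snd.ae (Measure.quasiMeasurePreserving_snd.ae (hS' θ))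
  change ∀ᵐ f ∂((coin p).prod (S.law.prod S'.law)), _
  filter_upwards [h₁, h₂]
  rintro ⟨b, f, f'⟩ hf hf' W
  cases b
  · simpa [PIRScheme.timeShare] using hf' W
  · simpa [PIRScheme.timeShare] using hf W

lemma IsPrivate.timeShare (p : unitInterval) (hS : S.IsPrivate) (hS' : S'.IsPrivate) :
    (timeShare p S S').IsPrivate := by
  intro n θ θ' q
  have key : ∀ θ, {f : Bool × S.Seed × S'.Seed |
      (if f.1 then true :: S.query n θ f.2.1 else false :: S'.query n θ f.2.2) = q} =
      match q with
      | [] => ∅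
      | true :: q => {true} ×ˢ ({f | S.query n θ f = q} ×ˢ Set.univ)
      | false :: q => {false} ×ˢ (Set.univ ×ˢ {f | S'.query n θ f = q}) := by
    intro θ
    ext ⟨b, f, f'⟩
    cases b <;> rcases q with _ | ⟨_ | _, q⟩ <;> simp
  change (coin p).prod (S.law.prod S'.law) {f : Bool × S.Seed × S'.Seed |
      (if f.1 then true :: S.query n θ f.2.1 else false :: S'.query n θ f.2.2) = q} =
    (coin p).prod (S.law.prod S'.law) {f : Bool × S.Seed × S'.Seed |
      (if f.1 then true :: S.query n θ' f.2.1 else false :: S'.query n θ' f.2.2) = q}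
  rw [key θ, key θ']
  rcases q with _ | ⟨_ | _, q⟩
  · rfl
  · simp only [Measure.prod_prod, hS' n θ θ' q]
  · simp only [Measure.prod_prod, hS n θ θ' q]

/-! ### Schemes with shifted queries -/

section Shift

variable {G : Type} [AddCommGroup G] [Fintype G] [Encodable G]

/-- Bit strings as names of the elements of a countable group. -/
def groupOfBits (G : Type) [AddCommGroup G] [Encodable G] (q : List Bool) : G :=
  (Encodable.decode q.length).getD 0

/-- The bit string that names an element of a countable group. -/
def bitsOfGroup (x : G) : List Bool := List.replicate (Encodable.encode x) true

omit [Fintype G] in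
@[simp]
lemma groupOfBits_bitsOfGroup (x : G) : groupOfBits G (bitsOfGroup x) = x := by
  simp [groupOfBits, bitsOfGroup]

open Classical in
/-- The user draws a uniform element `x` of a finite group `G` and sends `x + c n θ` to server
`n`, which returns `d n` bits. -/
noncomputable def shiftScheme (c : Fin N → Fin M → G) (d : Fin N → ℕ)
    (ans : Fin N → G → Library M L → List Bool) (hans : ∀ n x W, (ans n x W).length = d n) :
    PIRScheme N M L where
  Seed := G
  seedSpace := ⊤
  law := @PMF.toMeasure G ⊤ (PMF.uniformOfFintype G)
  law_prob := @PMF.toMeasure.isProbabilityMeasure G ⊤ _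
  query n θ x := bitsOfGroup (x + c n θ)
  query_meas _ _ _ := trivial
  size n _ := d n
  answer n q W := ans n (groupOfBits G q) W
  answer_length n _ W := hans n _ W
  decode θ Q A :=
    if h : ∃ W : Library M L, ∀ n, ans n (groupOfBits G (Q n)) W = A n then h.choose θ
    else fun _ => false

variable {c : Fin N → Fin M → G} {d : Fin N → ℕ} {ans : Fin N → G → Library M L → List Bool}
  {hans : ∀ n x W, (ans n x W).length = d n}

lemma shiftScheme_hasSizes : (shiftScheme c d ans hans).HasSizes d := fun _ _ _ => rfl

/-- The decoder picks any library consistent with the answers, so it is enough that equal answers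
force equal desired messages. -/
lemma shiftScheme_isCorrect (h : ∀ θ x W W',
    (∀ n, ans n (x + c n θ) W = ans n (x + c n θ) W') → W θ = W' θ) :
    (shiftScheme c d ans hans).IsCorrect := by
  refine fun θ => Eventually.of_forall fun (x : G) W => ?_
  have hex : ∃ W' : Library M L, ∀ n, ans n (groupOfBits G (bitsOfGroup (x + c n θ))) W' =
      ans n (groupOfBits G (bitsOfGroup (x + c n θ))) W := ⟨W, fun _ => rfl⟩
  have hdec : (shiftScheme c d ans hans).decode θ
      (fun n => (shiftScheme c d ans hans).query n θ x)
      (fun n => (shiftScheme c d ans hans).answer n ((shiftScheme c d ans hans).query n θ x) W) =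
      hex.choose θ := dif_pos hex
  rw [hdec]
  refine h θ x _ _ fun n => ?_
  simpa only [groupOfBits_bitsOfGroup] using hex.choose_spec n

/-- A translate of a uniform group element is uniform, so each single query has a law free of `θ`.
-/
lemma shiftScheme_isPrivate : (shiftScheme c d ans hans).IsPrivate := by
  classical
  have key : ∀ n θ q, (shiftScheme c d ans hans).law
      {x | (shiftScheme c d ans hans).query n θ x = q} =
      (Fintype.card {x : G // bitsOfGroup x = q} : ℝ≥0∞) / Fintype.card G := by
    intro n θ q
    let _ : MeasurableSpace G := ⊤
    change (PMF.uniformOfFintype G).toMeasure {x : G | bitsOfGroup (x + c n θ) = q} = _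
    rw [PMF.toMeasure_uniformOfFintype_apply _ MeasurableSpace.measurableSet_top]
    congr 2
    exact Fintype.card_congr ((Equiv.addRight (c n θ)).subtypeEquiv fun _ => Iff.rfl)
  intro n θ θ' q
  rw [key, key]

end Shift

end PIRScheme

/-- A `k × b` array of bits as a string. -/
def bitArray {k b : ℕ} (r : Fin k → Fin b → Bool) : List Bool :=
  List.ofFn fun i : Fin (k * b) => r (finProdFinEquiv.symm i).1 (finProdFinEquiv.symm i).2

lemma length_bitArray {k b : ℕ} (r : Fin k → Fin b → Bool) : (bitArray r).length = k * b := by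
  simp [bitArray]

lemma bitArray_injective {k b : ℕ} {r r' : Fin k → Fin b → Bool} (h : bitArray r = bitArray r') :
    r = r' := by
  funext i j
  simpa using congrFun (List.ofFn_injective h) (finProdFinEquiv (i, j))

/-- Bit `i` of block `b` of a message of `B * k` bits. -/
def blockBit {B k L : ℕ} (h : B * k = L) (w : Fin L → Bool) (b : Fin B) (i : Fin k) : Bool :=
  w (Fin.cast h (finProdFinEquiv (b, i)))

lemma eq_of_blockBit {B k L : ℕ} (h : B * k = L) {w w' : Fin L → Bool}
    (hw : ∀ b i, blockBit h w b i = blockBit h w' b i) : w = w' := by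
  subst h
  funext j
  have := hw (finProdFinEquiv.symm j).1 (finProdFinEquiv.symm j).2
  simpa only [blockBit, Prod.mk.eta, Equiv.apply_symm_apply, Fin.cast_eq_self] using this

/-! ### The schemes with download sizes (24, 0), (12, 4) and (8, 6) -/

open PIRScheme

/-- Download the whole library from the first server. -/
noncomputable def fullScheme : PIRScheme 2 3 8 :=
  shiftScheme (G := Unit) (fun _ _ => 0) ![24, 0]
    (fun n _ W => if n = 0 then bitArray W else []) (by
      intro n _ W
      fin_cases n
      · exact length_bitArray W
      · rfl)

lemma fullScheme_isCorrect : fullScheme.IsCorrect :=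
  shiftScheme_isCorrect fun θ _ _ _ h => congrFun (bitArray_injective (h 0)) θ

/-- Bit `x m` of every message `m`, in each of four blocks. -/
def pairSingles (x : Fin 3 → Fin 2) (W : Library 3 8) (m : Fin 3) (b : Fin 4) : Bool :=
  blockBit rfl (W m) b (x m)

/-- The sum of the bits `x m` of the messages `m`, in each of four blocks. -/
def pairSum (x : Fin 3 → Fin 2) (W : Library 3 8) (_ : Fin 1) (b : Fin 4) : Bool :=
  (blockBit rfl (W 0) b (x 0)).xor
    ((blockBit rfl (W 1) b (x 1)).xor (blockBit rfl (W 2) b (x 2)))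

/-- In each of four blocks of two bits, the first server returns one random bit of every message,
the second the sum of one bit of every message; the queried bits differ for the desired message
and agree for the others. -/
noncomputable def pairScheme : PIRScheme 2 3 8 :=
  shiftScheme (G := Fin 3 → Fin 2) ![fun _ => 0, fun θ => Pi.single θ 1] ![12, 4]
    ![fun x W => bitArray (pairSingles x W), fun x W => bitArray (pairSum x W)]
    (Fin.forall_fin_two.2 ⟨fun _ _ => length_bitArray _, fun _ _ => length_bitArray _⟩)

/-- One bit of each block is sent in the clear; the other is the sum from the second server minus
two undesired bits known from the first. -/
lemma pairScheme_isCorrect : pairScheme.IsCorrect := by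
  refine shiftScheme_isCorrect fun θ x W W' h => ?_
  have h₀ : pairSingles (x + 0) W = pairSingles (x + 0) W' := bitArray_injective (h 0)
  have h₁ : pairSum (x + Pi.single θ 1) W = pairSum (x + Pi.single θ 1) W' :=
    bitArray_injective (h 1)
  rw [add_zero] at h₀
  refine eq_of_blockBit (B := 4) (k := 2) rfl fun b i => ?_
  have hi : ∀ a i : Fin 2, i = a ∨ i = a + 1 := by decide
  have e := fun m => congrFun₂ h₀ m b
  have g := congrFun₂ h₁ 0 b
  simp only [pairSingles] at e
  rcases hi (x θ) i with rfl | rfl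
  · exact e θ
  · fin_cases θ <;> simpa [pairSum, e] using g

/-- In each of two blocks, bit `x m` of every message `m` and the sum of the bits `x m + 2`. -/
def quadSingles (x : Fin 3 → Fin 4) (W : Library 3 8) (j : Fin 4) (b : Fin 2) : Bool :=
  ![blockBit rfl (W 0) b (x 0), blockBit rfl (W 1) b (x 1), blockBit rfl (W 2) b (x 2),
    (blockBit rfl (W 0) b (x 0 + 2)).xor
      ((blockBit rfl (W 1) b (x 1 + 2)).xor (blockBit rfl (W 2) b (x 2 + 2)))] j

/-- In each of two blocks, one sum for every pair of messages, with bits `x m` and `x m + 2` of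
message `m`. -/
def quadSums (x : Fin 3 → Fin 4) (W : Library 3 8) (j : Fin 3) (b : Fin 2) : Bool :=
  ![(blockBit rfl (W 0) b (x 0)).xor (blockBit rfl (W 1) b (x 1)),
    (blockBit rfl (W 0) b (x 0 + 2)).xor (blockBit rfl (W 2) b (x 2)),
    (blockBit rfl (W 1) b (x 1 + 2)).xor (blockBit rfl (W 2) b (x 2 + 2))] j

/-- In each of two blocks of four bits, the first server returns one random bit of every message
and the sum of one further bit of each, the second server the sums for the three pairs of
messages. The second query is such that the undesired bits are those sent by the first server,
and the desired bits are new. -/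
noncomputable def quadScheme : PIRScheme 2 3 8 :=
  shiftScheme (G := Fin 3 → Fin 4) ![fun _ => 0, ![![1, 0, 0], ![0, 1, 2], ![2, 2, 1]]] ![8, 6]
    ![fun x W => bitArray (quadSingles x W), fun x W => bitArray (quadSums x W)]
    (Fin.forall_fin_two.2 ⟨fun _ _ => length_bitArray _, fun _ _ => length_bitArray _⟩)

/-- Bit `x θ` comes in the clear. Bits `x θ + 1` and `x θ + 3` come from the two pair sums involving
message `θ`, whose other terms are undesired bits sent in the clear. The third pair sum consists of
the undesired bits `x m + 2`; removing it from the triple sum leaves bit `x θ + 2`. The offsets `c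
θ` are chosen to produce this alignment. -/
lemma quadScheme_isCorrect : quadScheme.IsCorrect := by
  refine shiftScheme_isCorrect fun θ x W W' h => ?_
  set c : Fin 3 → Fin 3 → Fin 4 := ![![1, 0, 0], ![0, 1, 2], ![2, 2, 1]] with hc
  have h₀ : quadSingles (x + 0) W = quadSingles (x + 0) W' := bitArray_injective (h 0)
  have h₁ : quadSums (x + c θ) W = quadSums (x + c θ) W' := bitArray_injective (h 1)
  rw [add_zero] at h₀
  refine eq_of_blockBit (B := 2) (k := 4) rfl fun b i => ?_
  have hi : ∀ a i : Fin 4, i = a ∨ i = a + 1 ∨ i = a + 2 ∨ i = a + 3 := by decide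
  have hx : ∀ a : Fin 4, a + 2 + 2 = a ∧ a + 1 + 2 = a + 3 := by decide
  have e0 := congrFun₂ h₀ 0 b
  have e1 := congrFun₂ h₀ 1 b
  have e2 := congrFun₂ h₀ 2 b
  have e3 := congrFun₂ h₀ 3 b
  have g0 := congrFun₂ h₁ 0 b
  have g1 := congrFun₂ h₁ 1 b
  have g2 := congrFun₂ h₁ 2 b
  simp only [quadSingles, quadSums, Matrix.cons_val, Pi.add_apply] at e0 e1 e2 e3 g0 g1 g2
  -- Cancels a known pair from the triple sum; one clause for each desired message.
  have hxor : ∀ a b c a' b' c' : Bool, (a ^^ (b ^^ c)) = (a' ^^ (b' ^^ c')) →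
      ((b ^^ c) = (b' ^^ c') → a = a') ∧ ((a ^^ c) = (a' ^^ c') → b = b') ∧
      ((a ^^ b) = (a' ^^ b') → c = c') := by decide
  have e := hxor _ _ _ _ _ _ e3
  rcases hi (x θ) i with rfl | rfl | rfl | rfl <;> fin_cases θ <;>
    simp [hc, hx] at g0 g1 g2 ⊢
  -- The goals come in groups of three, one per desired message, for the bits `x θ`, `x θ + 1`, `x θ
  -- + 2`, `x θ + 3`.
  · exact e0
  · exact e1
  · exact e2
  · simpa [e1] using g0
  · simpa [e0] using g0
  · simpa [e0] using g1
  · exact e.1 g2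
  · exact e.2.1 g1
  · exact e.2.2 g0
  · simpa [e2] using g1
  · simpa [e2] using g2
  · simpa [e1] using g2

/-! ### The linear program -/

section LinearProgram

variable {μ : Fin 2 → ℝ} {R : ℝ}

/-- The constraints for `L = 8` with `D = a + b` eliminated; `a ≥ 12 - D / 2` is not listed because
it follows from `4 ≤ a` and `20 ≤ 2 * a + b`. -/
lemma mem_lpValues {a b v : ℝ} (ha : 4 ≤ a) (hb : 0 ≤ b) (h₀ : 14 ≤ a + b) (h₁ : a + b ≤ 8 / R)
    (h₂ : 24 ≤ a + 3 * b) (h₃ : 20 ≤ a + 2 * b) (h₄ : 20 ≤ 2 * a + b)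
    (hv : v = 2 * (μ 0 * a + μ 1 * b)) : v ∈ lpValues 8 μ R := by
  refine ⟨![a, b], a + b, Fin.forall_fin_two.2 ⟨by simp; linarith, by simpa using hb⟩, by simp,
    by linarith, h₁, Fin.forall_fin_two.2 ⟨max_le ?_ ?_, max_le ?_ ?_⟩, by simpa using hv⟩ <;>
  simp <;> linarith

lemma lpValues_anti {R R' : ℝ} (hR : 0 < R) (h : R ≤ R') : lpValues 8 μ R' ⊆ lpValues 8 μ R := by
  rintro v ⟨d, D, h0, hD, h1, h2, h3⟩
  exact ⟨d, D, h0, hD, h1, h2.trans (by gcongr), h3⟩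

/-- In terms of the total download `D`, the objective is at least a piecewise linear function. -/
lemma exists_le_of_mem_lpValues {v : ℝ} (hμ : μ 0 ≤ μ 1) (hv : v ∈ lpValues 8 μ R) :
    ∃ D : ℝ, 14 ≤ D ∧ D ≤ 8 * (1 / R) ∧ 2 * (μ 0 * D + (μ 1 - μ 0) * (12 - D / 2)) ≤ v ∧
      2 * (μ 0 * D + (μ 1 - μ 0) * (20 - D)) ≤ v := by
  obtain ⟨d, D, -, hD, h1, h2, h3, rfl⟩ := hv
  have h := h3 1
  rw [max_le_iff] at h
  rw [Fin.sum_univ_two] at hD ⊢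
  have h0 : d 0 = D - d 1 := by linarith
  have hδ : 0 ≤ μ 1 - μ 0 := by linarith
  have e1 := mul_le_mul_of_nonneg_left h.1 hδ
  have e2 := mul_le_mul_of_nonneg_left h.2 hδ
  refine ⟨D, by linarith, by rwa [mul_one_div], ?_, ?_⟩ <;> rw [h0] <;> linarith

/-- The bound with `20 - D` has slope `2 * (2 * μ 0 - μ 1)` in `D`; by its sign it is smallest at `D
= 14` or at `D = 8 / R`, which give the two terms. -/
lemma le_lpValues_high {v : ℝ} (hμ : μ 0 ≤ μ 1) (hv : v ∈ lpValues 8 μ R) :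
    min (16 * μ 0 + 12 * μ 1) (16 * (5 / 2 * (μ 1 - μ 0) + 1 / R * (2 * μ 0 - μ 1))) ≤ v := by
  obtain ⟨D, h1, h2, -, h4⟩ := exists_le_of_mem_lpValues hμ hv
  rcases le_total (μ 1) (2 * μ 0) with h | h
  · refine (min_le_left _ _).trans ?_
    nlinarith [mul_nonneg (sub_nonneg.2 h) (sub_nonneg.2 h1)]
  · refine (min_le_right _ _).trans ?_
    nlinarith [mul_nonneg (sub_nonneg.2 h) (sub_nonneg.2 h2)]

/-- The bounds cross at `D = 16`. Below it the slope `2 * (2 * μ 0 - μ 1)` decides between `D = 14`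
and `D = 16`, above it the slope `3 * μ 0 - μ 1` decides between `D = 16` and `D = 8 / R`. -/
lemma le_lpValues_low {v : ℝ} (hμ : μ 0 ≤ μ 1) (hv : v ∈ lpValues 8 μ R) :
    min (16 * μ 0 + 12 * μ 1) (min (24 * μ 0 + 8 * μ 1)
      (8 * (3 * (μ 1 - μ 0) + 1 / R * (3 * μ 0 - μ 1)))) ≤ v := by
  obtain ⟨D, h1, h2, h3, h4⟩ := exists_le_of_mem_lpValues hμ hv
  rcases le_total D 16 with hD | hD
  · rcases le_total (μ 1) (2 * μ 0) with h | h
    · refine (min_le_left _ _).trans ?_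
      nlinarith [mul_nonneg (sub_nonneg.2 h) (sub_nonneg.2 h1)]
    · refine ((min_le_right _ _).trans (min_le_left _ _)).trans ?_
      nlinarith [mul_nonneg (sub_nonneg.2 h) (sub_nonneg.2 hD)]
  · rcases le_total (μ 1) (3 * μ 0) with h | h
    · refine ((min_le_right _ _).trans (min_le_left _ _)).trans ?_
      nlinarith [mul_nonneg (sub_nonneg.2 h) (sub_nonneg.2 hD)]
    · refine ((min_le_right _ _).trans (min_le_right _ _)).trans ?_
      nlinarith [mul_nonneg (sub_nonneg.2 h) (sub_nonneg.2 h2)]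

lemma isLeast_lpValues_high (hμ : μ 0 ≤ μ 1) (hR : R ∈ Set.Icc (1 / 2 : ℝ) (4 / 7)) :
    IsLeast (lpValues 8 μ R)
      (min (16 * μ 0 + 12 * μ 1) (16 * (5 / 2 * (μ 1 - μ 0) + 1 / R * (2 * μ 0 - μ 1)))) := by
  have hR0 : 0 < R := by linarith [hR.1]
  have h1 : 14 ≤ 8 / R := by rw [le_div_iff₀ hR0]; linarith [hR.2]
  have h2 : 8 / R ≤ 16 := by rw [div_le_iff₀ hR0]; linarith [hR.1]
  refine ⟨?_, fun v hv => le_lpValues_high hμ hv⟩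
  rcases min_choice (16 * μ 0 + 12 * μ 1)
    (16 * (5 / 2 * (μ 1 - μ 0) + 1 / R * (2 * μ 0 - μ 1))) with h | h <;> rw [h]
  · exact mem_lpValues (a := 8) (b := 6) (by norm_num) (by norm_num) (by norm_num) (by linarith)
      (by norm_num) (by norm_num) (by norm_num) (by ring)
  -- The point with full budget `D = 8 / R` and `b = 20 - D` tight.
  · exact mem_lpValues (a := 2 * (8 / R) - 20) (b := 20 - 8 / R) (by linarith) (by linarith)
      (by linarith) (by linarith) (by linarith) (by linarith) (by linarith) (by ring)

lemma isLeast_lpValues_low (hμ : μ 0 ≤ μ 1) (hR : R ∈ Set.Icc (1 / 3 : ℝ) (1 / 2)) :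
    IsLeast (lpValues 8 μ R)
      (min (16 * μ 0 + 12 * μ 1) (min (24 * μ 0 + 8 * μ 1)
        (8 * (3 * (μ 1 - μ 0) + 1 / R * (3 * μ 0 - μ 1))))) := by
  have hR0 : 0 < R := by linarith [hR.1]
  have h1 : 16 ≤ 8 / R := by rw [le_div_iff₀ hR0]; linarith [hR.2]
  have h2 : 8 / R ≤ 24 := by rw [div_le_iff₀ hR0]; linarith [hR.1]
  refine ⟨?_, fun v hv => le_lpValues_low hμ hv⟩
  rcases min_choice (16 * μ 0 + 12 * μ 1) (min (24 * μ 0 + 8 * μ 1)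
    (8 * (3 * (μ 1 - μ 0) + 1 / R * (3 * μ 0 - μ 1)))) with h | h <;> rw [h]
  · exact mem_lpValues (a := 8) (b := 6) (by norm_num) (by norm_num) (by norm_num) (by linarith)
      (by norm_num) (by norm_num) (by norm_num) (by ring)
  rcases min_choice (24 * μ 0 + 8 * μ 1)
    (8 * (3 * (μ 1 - μ 0) + 1 / R * (3 * μ 0 - μ 1))) with h | h <;> rw [h]
  · exact mem_lpValues (a := 12) (b := 4) (by norm_num) (by norm_num) (by norm_num) (by linarith)
      (by norm_num) (by norm_num) (by norm_num) (by ring)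
  -- Again `D = 8 / R`, now with `b = 12 - D / 2` tight.
  · exact mem_lpValues (a := 3 / 2 * (8 / R) - 12) (b := 12 - 8 / R / 2) (by linarith)
      (by linarith) (by linarith) (by linarith) (by linarith) (by linarith) (by linarith) (by ring)

end LinearProgram

/-! ### Optimal peak age -/

section Optimal

variable {Ω : Type*} [MeasurableSpace Ω] {P : Measure Ω} [IsProbabilityMeasure P]
  {Z : Fin 2 → ℕ → Ω → ℝ} {μ : Fin 2 → ℝ} {R : ℝ} {θ : Fin 3}

/-- Every feasible peak age is at least the value of a feasible point of the linear program. -/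
lemma exists_lpValue_le (hZ : IsDelayModel P Z μ) (hR : 0 < R) {v : ℝ≥0∞}
    (hv : v ∈ peakValues P 3 8 Z θ R) : ∃ w ∈ lpValues 8 μ R, ENNReal.ofReal w ≤ v := by
  obtain ⟨S, hS, rfl⟩ := hv
  have hint := hS.integrable hR
  have hb := PIRScheme.meanDownload_bounds hS.1 hS.2.1 hint θ
  have hD := hS.sum_meanDownload_le hR (by norm_num) θ
  push_cast at hb hD
  exact ⟨_, ⟨fun n => S.meanDownload n θ, _, fun n => S.meanDownload_nonneg n θ, rfl, hb.1, hD,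
    hb.2, rfl⟩, le_peakAoI hZ (fun n => hint n θ) (hS.1.ae_download_pos (by norm_num) θ)⟩

/-- The linear program is a relaxation of the retrieval problem, so a scheme attaining its minimum
is optimal. -/
lemma isLeast_peakValues (hZ : IsDelayModel P Z μ) (hR : 0 < R) {m : ℝ}
    (hm : IsLeast (lpValues 8 μ R) m) (hmem : ENNReal.ofReal m ∈ peakValues P 3 8 Z θ R) :
    IsLeast (peakValues P 3 8 Z θ R) (ENNReal.ofReal m) := by
  refine ⟨hmem, fun v hv => ?_⟩
  obtain ⟨w, hw, hwv⟩ := exists_lpValue_le hZ hR hv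
  exact (ENNReal.ofReal_le_ofReal (hm.2 hw)).trans hwv

lemma feasible_and_peakAoI_eq (hZ : IsDelayModel P Z μ) (hR : 0 < R) {S : PIRScheme 2 3 8}
    (hc : S.IsCorrect) (hp : S.IsPrivate) {B : ℕ} (hB : ∀ n θ f, S.download n θ f ≤ B) {a b v : ℝ}
    (ha : ∀ θ, S.meanDownload 0 θ = a) (hb : ∀ θ, S.meanDownload 1 θ = b) (hab : a + b ≤ 8 / R)
    (hv : 2 * (μ 0 * a + μ 1 * b) = v) :
    S.Feasible R ∧ peakAoI P Z S θ = ENNReal.ofReal v := by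
  have hint := fun n θ => S.integrable_download_of_bounded n θ (hB n θ)
  constructor
  · refine PIRScheme.feasible_of_meanDownload hc hp hint hR (by norm_num) fun θ => ?_
    rw [Fin.sum_univ_two, ha, hb]
    exact_mod_cast hab
  · rw [peakAoI_eq hZ (fun n => hint n θ) (hc.ae_download_pos (by norm_num) θ) fun n => hB n θ,
      Fin.sum_univ_two, ha, hb, hv]

lemma feasible_and_peakAoI_eq_of_hasSizes (hZ : IsDelayModel P Z μ) (hR : 0 < R)
    {S : PIRScheme 2 3 8} {a b : ℕ} {v : ℝ} (hc : S.IsCorrect) (hp : S.IsPrivate)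
    (hs : S.HasSizes ![a, b]) (hab : (a + b : ℝ) ≤ 8 / R) (hv : 2 * (μ 0 * a + μ 1 * b) = v) :
    S.Feasible R ∧ peakAoI P Z S θ = ENNReal.ofReal v :=
  feasible_and_peakAoI_eq hZ hR hc hp (B := a + b)
    (fun n θ f => by
      rw [hs n θ f]
      fin_cases n
      · exact Nat.le_add_right a b
      · exact Nat.le_add_left b a)
    (hs.meanDownload_eq 0) (hs.meanDownload_eq 1) hab hv

lemma feasible_and_peakAoI_eq_of_timeShare (hZ : IsDelayModel P Z μ) (hR : 0 < R)
    {S S' : PIRScheme 2 3 8} {a b a' b' : ℕ} {v : ℝ} (hc : S.IsCorrect) (hp : S.IsPrivate)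
    (hs : S.HasSizes ![a, b]) (hc' : S'.IsCorrect) (hp' : S'.IsPrivate)
    (hs' : S'.HasSizes ![a', b']) (p : unitInterval)
    (hab : (p * (a + b) + (1 - p) * (a' + b') : ℝ) ≤ 8 / R)
    (hv : 2 * (μ 0 * (p * a + (1 - p) * a') + μ 1 * (p * b + (1 - p) * b')) = v) :
    (PIRScheme.timeShare p S S').Feasible R ∧
      peakAoI P Z (PIRScheme.timeShare p S S') θ = ENNReal.ofReal v :=
  feasible_and_peakAoI_eq hZ hR (hc.timeShare p hc') (hp.timeShare p hp')
    (PIRScheme.timeShare_download_le p hs hs') (PIRScheme.timeShare_meanDownload p hs hs' 0)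
    (PIRScheme.timeShare_meanDownload p hs hs' 1)
    (by simp only [Matrix.cons_val_zero, Matrix.cons_val_one]; linarith)
    (by simpa using hv)

end Optimal

theorem mainTheorem1 :
    ∃ S₁ S₃ S₄ : PIRScheme 2 3 8,
      (S₁.IsCorrect ∧ S₁.IsPrivate ∧ S₁.HasSizes ![24, 0]) ∧
      (S₃.IsCorrect ∧ S₃.IsPrivate ∧ S₃.HasSizes ![8, 6]) ∧
      (S₄.IsCorrect ∧ S₄.IsPrivate ∧ S₄.HasSizes ![12, 4]) ∧
      ∀ (Ω : Type*) [MeasurableSpace Ω] (P : Measure Ω) [IsProbabilityMeasure P]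
        (Z : Fin 2 → ℕ → Ω → ℝ) (μ : Fin 2 → ℝ), IsDelayModel P Z μ → μ 0 ≤ μ 1 →
      ∀ θ : Fin 3,
        (∀ R ∈ Set.Icc (1 / 2 : ℝ) (4 / 7),
          IsLeast (peakValues P 3 8 Z θ R) (ENNReal.ofReal
            (min (16 * μ 0 + 12 * μ 1)
              (16 * (5 / 2 * (μ 1 - μ 0) + 1 / R * (2 * μ 0 - μ 1))))) ∧
          IsLeast (lpValues 8 μ R)
            (min (16 * μ 0 + 12 * μ 1)
              (16 * (5 / 2 * (μ 1 - μ 0) + 1 / R * (2 * μ 0 - μ 1)))) ∧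
          (S₃.Feasible R ∧ peakAoI P Z S₃ θ = ENNReal.ofReal (16 * μ 0 + 12 * μ 1)) ∧
          ∃ p : unitInterval, (p : ℝ) = 4 / R - 7 ∧
            (PIRScheme.timeShare p S₄ S₃).Feasible R ∧
            peakAoI P Z (PIRScheme.timeShare p S₄ S₃) θ = ENNReal.ofReal
              (16 * (5 / 2 * (μ 1 - μ 0) + 1 / R * (2 * μ 0 - μ 1)))) ∧
        (∀ R ∈ Set.Icc (1 / 3 : ℝ) (1 / 2),
          IsLeast (peakValues P 3 8 Z θ R) (ENNReal.ofReal
            (min (16 * μ 0 + 12 * μ 1) (min (24 * μ 0 + 8 * μ 1)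
              (8 * (3 * (μ 1 - μ 0) + 1 / R * (3 * μ 0 - μ 1)))))) ∧
          IsLeast (lpValues 8 μ R)
            (min (16 * μ 0 + 12 * μ 1) (min (24 * μ 0 + 8 * μ 1)
              (8 * (3 * (μ 1 - μ 0) + 1 / R * (3 * μ 0 - μ 1))))) ∧
          (S₃.Feasible R ∧ peakAoI P Z S₃ θ = ENNReal.ofReal (16 * μ 0 + 12 * μ 1)) ∧
          (S₄.Feasible R ∧ peakAoI P Z S₄ θ = ENNReal.ofReal (24 * μ 0 + 8 * μ 1)) ∧
          ∃ p : unitInterval, (p : ℝ) = 1 / R - 2 ∧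
            (PIRScheme.timeShare p S₁ S₄).Feasible R ∧
            peakAoI P Z (PIRScheme.timeShare p S₁ S₄) θ = ENNReal.ofReal
              (8 * (3 * (μ 1 - μ 0) + 1 / R * (3 * μ 0 - μ 1)))) ∧
        MonotoneOn (fun R => sInf (peakValues P 3 8 Z θ R)) (Set.Icc (1 / 3 : ℝ) (4 / 7)) ∧
        MonotoneOn (fun R => sInf (lpValues 8 μ R)) (Set.Icc (1 / 3 : ℝ) (4 / 7)) := by
  have c₁ : fullScheme.IsCorrect := fullScheme_isCorrect
  have p₁ : fullScheme.IsPrivate := PIRScheme.shiftScheme_isPrivate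
  have s₁ : fullScheme.HasSizes ![24, 0] := PIRScheme.shiftScheme_hasSizes
  have c₃ : quadScheme.IsCorrect := quadScheme_isCorrect
  have p₃ : quadScheme.IsPrivate := PIRScheme.shiftScheme_isPrivate
  have s₃ : quadScheme.HasSizes ![8, 6] := PIRScheme.shiftScheme_hasSizes
  have c₄ : pairScheme.IsCorrect := pairScheme_isCorrect
  have p₄ : pairScheme.IsPrivate := PIRScheme.shiftScheme_isPrivate
  have s₄ : pairScheme.HasSizes ![12, 4] := PIRScheme.shiftScheme_hasSizes
  refine ⟨fullScheme, quadScheme, pairScheme, ⟨c₁, p₁, s₁⟩, ⟨c₃, p₃, s₃⟩, ⟨c₄, p₄, s₄⟩, ?_⟩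
  intro Ω _ P _ Z μ hZ hμ θ
  refine ⟨fun R hR => ?_, fun R hR => ?_, ?_, ?_⟩
  · have hR0 : 0 < R := by linarith [hR.1]
    have h1 : 14 ≤ 8 / R := by rw [le_div_iff₀ hR0]; linarith [hR.2]
    have h2 : 8 / R ≤ 16 := by rw [div_le_iff₀ hR0]; linarith [hR.1]
    have e : 4 / R = 8 / R / 2 := by ring
    have hlp := isLeast_lpValues_high hμ hR
    have hquad := feasible_and_peakAoI_eq_of_hasSizes (θ := θ)
      (v := 16 * μ 0 + 12 * μ 1) hZ hR0 c₃ p₃ s₃ (by push_cast; linarith) (by push_cast; ring)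
    -- The mixture downloads `16 * p + 14 * (1 - p)` bits on average; equating this with `8 / R`
    -- gives `p`.
    have hp : 4 / R - 7 ∈ unitInterval := ⟨by linarith, by linarith⟩
    have hshare := feasible_and_peakAoI_eq_of_timeShare (θ := θ)
      (v := 16 * (5 / 2 * (μ 1 - μ 0) + 1 / R * (2 * μ 0 - μ 1))) hZ hR0 c₄ p₄ s₄ c₃ p₃ s₃
      ⟨_, hp⟩ (by push_cast; linarith) (by push_cast; ring)
    refine ⟨isLeast_peakValues hZ hR0 hlp ?_, hlp, hquad, ⟨_, hp⟩, rfl, hshare⟩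
    rcases min_choice (16 * μ 0 + 12 * μ 1)
      (16 * (5 / 2 * (μ 1 - μ 0) + 1 / R * (2 * μ 0 - μ 1))) with h | h <;> rw [h]
    · exact ⟨_, hquad.1, hquad.2.symm⟩
    · exact ⟨_, hshare.1, hshare.2.symm⟩
  · have hR0 : 0 < R := by linarith [hR.1]
    have h1 : 16 ≤ 8 / R := by rw [le_div_iff₀ hR0]; linarith [hR.2]
    have h2 : 8 / R ≤ 24 := by rw [div_le_iff₀ hR0]; linarith [hR.1]
    have e : 1 / R = 8 / R / 8 := by ring
    have hlp := isLeast_lpValues_low hμ hR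
    have hquad := feasible_and_peakAoI_eq_of_hasSizes (θ := θ)
      (v := 16 * μ 0 + 12 * μ 1) hZ hR0 c₃ p₃ s₃ (by push_cast; linarith) (by push_cast; ring)
    have hpair := feasible_and_peakAoI_eq_of_hasSizes (θ := θ)
      (v := 24 * μ 0 + 8 * μ 1) hZ hR0 c₄ p₄ s₄ (by push_cast; linarith) (by push_cast; ring)
    -- Here the equation is `24 * p + 16 * (1 - p) = 8 / R`.
    have hp : 1 / R - 2 ∈ unitInterval := ⟨by linarith, by linarith⟩
    have hshare := feasible_and_peakAoI_eq_of_timeShare (θ := θ)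
      (v := 8 * (3 * (μ 1 - μ 0) + 1 / R * (3 * μ 0 - μ 1))) hZ hR0 c₁ p₁ s₁ c₄ p₄ s₄
      ⟨_, hp⟩ (by push_cast; linarith) (by push_cast; ring)
    refine ⟨isLeast_peakValues hZ hR0 hlp ?_, hlp, hquad, hpair, ⟨_, hp⟩, rfl, hshare⟩
    rcases min_choice (16 * μ 0 + 12 * μ 1) (min (24 * μ 0 + 8 * μ 1)
      (8 * (3 * (μ 1 - μ 0) + 1 / R * (3 * μ 0 - μ 1)))) with h | h <;> rw [h]
    · exact ⟨_, hquad.1, hquad.2.symm⟩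
    rcases min_choice (24 * μ 0 + 8 * μ 1)
      (8 * (3 * (μ 1 - μ 0) + 1 / R * (3 * μ 0 - μ 1))) with h | h <;> rw [h]
    · exact ⟨_, hpair.1, hpair.2.symm⟩
    · exact ⟨_, hshare.1, hshare.2.symm⟩
  · intro R _ R' _ hRR'
    refine sInf_le_sInf ?_
    rintro v ⟨S, hS, rfl⟩
    exact ⟨S, hS.mono hRR', rfl⟩
  · intro R hR R' hR' hRR'
    -- Infima of real sets are monotone only for nonempty, bounded below sets. The lower bound comes
    -- from `le_lpValues_low`, which holds for every `R`.
    have hne : (lpValues 8 μ R').Nonempty := by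
      rcases le_total R' (1 / 2) with h | h
      · exact ⟨_, (isLeast_lpValues_low hμ ⟨hR'.1, h⟩).1⟩
      · exact ⟨_, (isLeast_lpValues_high hμ ⟨h, hR'.2⟩).1⟩
    exact csInf_le_csInf ⟨_, fun v hv => le_lpValues_low hμ hv⟩ hne
      (lpValues_anti (by linarith [hR.1]) hRR')
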